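/- Let $\Omega\subseteq\mathbb R^d$ be open, $T>0$, and let $a_{kj}:[0,T]\times\Omega\to\mathbb R$ ($k,j\in\{1,\dots,d\}$) be measurable and uniformly bounded, and suppose that for some $\eta>0$ $$\sum_{k,j=1}^d a_{kj}(t,x)\,\xi_k\xi_j\ \ge\ \eta|\xi|^2\qquad\text{for all }\xi\in\mathbb R^d\text{ and a.e. }(t,x)\in[0,T]\times\Omega .$$ For real-valued $u,v\in H^1(\Omega)$ put $$\mathfrak a(t,u,v)=\sum_{k,j=1}^d\int_\Omega a_{kj}(t,x)\,\partial_k u\,\partial_j v\,dx .$$ Let $V$ be either $H^1(\Omega)$ or $H^1_0(\Omega)$ (the closure of $C_c^\infty(\Omega)$ in $H^1(\Omega)$), and embed $V\hookrightarrow L^2(\Omega)\hookrightarrow V'$, where $g\in L^2(\Omega)$ acts on $V$ by $v\mapsto(g\,|\,v)_{L^2(\Omega)}$. Given $u_0\in L^2(\Omega)$ and $f\in L^2(0,T;V')$, a solution of the Cauchy problem with respect to $V$ is a function $u\in H^1(0,T;V')\cap L^2(0,T;V)$ (with $\dot u$ the weak derivative of $u$ as a $V'$-valued function) such that for a.e.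 $t\in(0,T)$ $$\langle\dot u(t),v\rangle+\mathfrak a(t,u(t),v)=\langle f(t),v\rangle\quad\text{for all }v\in V,\qquad\text{and}\quad u(0)=u_0;$$ here $u$ is identified with its continuous representative in $C([0,T];L^2(\Omega))$. Let $f\in L^2(0,T;H^1(\Omega)')$ with $f\ge 0$, i.e. $\langle f(t),v\rangle\ge 0$ for a.e. $t$, for every $v\in H^1(\Omega)$ with $v\ge 0$ a.e. in $\Omega$, and let $u_0\in L^2(\Omega)$ with $u_0\ge 0$ a.e. Let $\underline u$ be the solution with respect to $V=H^1_0(\Omega)$ (Dirichlet boundary conditions, with each $f(t)$ restricted to $H^1_0(\Omega)$), and let $\overline u$ be the solution with respect to $V=H^1(\Omega)$ (Neumann boundary conditions), for the same $f$ and $u_0$. Then, almost everywhere in $\Omega$, $$0\le\underline u(t)\le\overline u(t)\qquad\text{for all }t\in[0,T].$$ -/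

import Mathlib

open MeasureTheory Set
open scoped ENNReal InnerProductSpace Distributions

noncomputable section

namespace ParabolicForms

/-! ### Abstract Cauchy problems governed by a non-autonomous form -/

section Abstract

variable {V H X : Type*}
  [NormedAddCommGroup V] [InnerProductSpace ℝ V]
  [NormedAddCommGroup H] [InnerProductSpace ℝ H]
  [NormedAddCommGroup X] [NormedSpace ℝ X]

/-- Lebesgue measure on the time interval `(0, T)`. -/
abbrev timeMeasure (T : ℝ) : Measure ℝ := volume.restrict (Ioo 0 T)

/-- The open interval `(0, T)`. -/
def timeInterval (T : ℝ) : TopologicalSpace.Opens ℝ := ⟨Ioo 0 T, isOpen_Ioo⟩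

/-- `du` is a weak derivative of `u` on `(0, T)`: `-∫ φ'(s) u(s) ds = ∫ φ(s) du(s) ds`
for all scalar test functions `φ ∈ C_c^∞(0, T)`. -/
def IsWeakDerivative (T : ℝ) (u du : ℝ → X) : Prop :=
  ∀ φ : 𝓓(timeInterval T, ℝ),
    -∫ s, deriv φ s • u s ∂(timeMeasure T) = ∫ s, φ s • du s ∂(timeMeasure T)

/-- The canonical map `V → H ≅ H' → V'` attached to `j : V → H`, that is
`⟨v, w⟩ = (j v | j w)_H`. -/
def toDual (j : V →L[ℝ] H) (v : V) : StrongDual ℝ V := (innerSL ℝ (j v)).comp j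

/-- `v ∈ MR(V, V') = H¹(0,T;V') ∩ L²(0,T;V)`, with weak derivative `dv ∈ L²(0,T;V')`. -/
structure MaxReg (j : V →L[ℝ] H) (T : ℝ) (v : ℝ → V) (dv : ℝ → StrongDual ℝ V) : Prop where
  memLp : MemLp v 2 (timeMeasure T)
  memLp_deriv : MemLp dv 2 (timeMeasure T)
  weakDerivative : IsWeakDerivative T (fun t => toDual j (v t)) dv

/-- `u : [0,T] → H` is (the continuous representative in `C([0,T];H)` of) a solution
`v ∈ MR(V, V')` of `v'(t) + 𝓐(t) v(t) = f(t)` for a.e. `t`, with initial value `u₀`,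
where `⟨𝓐(t) v, w⟩ = a(t, v, w)`. -/
def IsSolution (j : V →L[ℝ] H) (T : ℝ) (a : ℝ → V → V → ℝ) (f : ℝ → StrongDual ℝ V)
    (u₀ : H) (u : ℝ → H) : Prop :=
  ContinuousOn u (Icc 0 T) ∧ u 0 = u₀ ∧
    ∃ (v : ℝ → V) (dv : ℝ → StrongDual ℝ V), MaxReg j T v dv ∧
      (∀ᵐ t ∂(timeMeasure T), u t = j (v t)) ∧
      ∀ᵐ t ∂(timeMeasure T), ∀ w : V, dv t w + a t (v t) w = f t w

end Abstract

/-! ### The spaces `H¹(Ω)` and `H¹₀(Ω)` -/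

section Sobolev

variable {d : ℕ}

/-- The real space `L²(Ω)`. -/
abbrev L2 (Ω : TopologicalSpace.Opens (EuclideanSpace ℝ (Fin d))) :=
  Lp ℝ 2 (volume.restrict (Ω : Set (EuclideanSpace ℝ (Fin d))))

/-- The space of square integrable vector fields on `Ω`. -/
abbrev L2Field (Ω : TopologicalSpace.Opens (EuclideanSpace ℝ (Fin d))) :=
  Lp (EuclideanSpace ℝ (Fin d)) 2 (volume.restrict (Ω : Set (EuclideanSpace ℝ (Fin d))))

/-- The partial derivative `∂ₖ φ`. -/
def partialDeriv (k : Fin d) (φ : EuclideanSpace ℝ (Fin d) → ℝ)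
    (x : EuclideanSpace ℝ (Fin d)) : ℝ :=
  fderiv ℝ φ x (EuclideanSpace.single k 1)

/-- `G` is the weak gradient of `u` in `Ω`. -/
def IsWeakGradient (Ω : TopologicalSpace.Opens (EuclideanSpace ℝ (Fin d)))
    (u : L2 Ω) (G : L2Field Ω) : Prop :=
  ∀ (φ : 𝓓(Ω, ℝ)) (k : Fin d),
    ∫ x in Ω, u x * partialDeriv k φ x = -∫ x in Ω, G x k * φ x

variable {Ω : TopologicalSpace.Opens (EuclideanSpace ℝ (Fin d))}

lemma memLp_testFunction (φ : 𝓓(Ω, ℝ)) :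
    MemLp φ 2 (volume.restrict (Ω : Set (EuclideanSpace ℝ (Fin d)))) :=
  φ.continuous.memLp_of_hasCompactSupport φ.hasCompactSupport

lemma memLp_partialDeriv (φ : 𝓓(Ω, ℝ)) (k : Fin d) :
    MemLp (partialDeriv k φ) 2 (volume.restrict (Ω : Set (EuclideanSpace ℝ (Fin d)))) :=
  ((φ.contDiff.continuous_fderiv (by simp)).clm_apply
    continuous_const).memLp_of_hasCompactSupport (φ.hasCompactSupport.fderiv_apply ℝ _)

lemma memLp_coord (G : L2Field Ω) (k : Fin d) :
    MemLp (fun x => G x k) 2 (volume.restrict (Ω : Set (EuclideanSpace ℝ (Fin d)))) :=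
  (Lp.memLp G).continuousLinearMap_comp (EuclideanSpace.proj (𝕜 := ℝ) k)

lemma IsWeakGradient.zero : IsWeakGradient Ω (0 : L2 Ω) (0 : L2Field Ω) := by
  intro φ k
  rw [integral_eq_zero_of_ae, integral_eq_zero_of_ae, neg_zero]
  · filter_upwards [Lp.coeFn_zero (EuclideanSpace ℝ (Fin d)) 2
      (volume.restrict (Ω : Set (EuclideanSpace ℝ (Fin d))))] with x hx
    rw [hx]; simp
  · filter_upwards [Lp.coeFn_zero ℝ 2
      (volume.restrict (Ω : Set (EuclideanSpace ℝ (Fin d))))] with x hx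
    rw [hx]; simp

lemma IsWeakGradient.add {u v : L2 Ω} {F G : L2Field Ω}
    (hu : IsWeakGradient Ω u F) (hv : IsWeakGradient Ω v G) :
    IsWeakGradient Ω (u + v) (F + G) := by
  intro φ k
  have e1 : ∫ x in Ω, (u + v : L2 Ω) x * partialDeriv k φ x
      = ∫ x in Ω, (u x * partialDeriv k φ x + v x * partialDeriv k φ x) := by
    refine integral_congr_ae ?_
    filter_upwards [Lp.coeFn_add u v] with x hx
    rw [hx, Pi.add_apply, add_mul]
  have e2 : ∫ x in Ω, (F + G : L2Field Ω) x k * φ x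
      = ∫ x in Ω, (F x k * φ x + G x k * φ x) := by
    refine integral_congr_ae ?_
    filter_upwards [Lp.coeFn_add F G] with x hx
    rw [hx, Pi.add_apply, PiLp.add_apply, add_mul]
  have e3 := integral_add ((Lp.memLp u).integrable_mul (memLp_partialDeriv φ k))
    ((Lp.memLp v).integrable_mul (memLp_partialDeriv φ k))
  have e4 := integral_add ((memLp_coord F k).integrable_mul (memLp_testFunction φ))
    ((memLp_coord G k).integrable_mul (memLp_testFunction φ))
  simp only [Pi.mul_apply] at e3 e4
  rw [e1, e2, e3, e4, hu φ k, hv φ k, neg_add]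

lemma IsWeakGradient.smul (c : ℝ) {u : L2 Ω} {F : L2Field Ω} (hu : IsWeakGradient Ω u F) :
    IsWeakGradient Ω (c • u) (c • F) := by
  intro φ k
  have e1 : ∫ x in Ω, (c • u : L2 Ω) x * partialDeriv k φ x
      = ∫ x in Ω, c * (u x * partialDeriv k φ x) := by
    refine integral_congr_ae ?_
    filter_upwards [Lp.coeFn_smul c u] with x hx
    rw [hx, Pi.smul_apply, smul_eq_mul, mul_assoc]
  have e2 : ∫ x in Ω, (c • F : L2Field Ω) x k * φ x = ∫ x in Ω, c * (F x k * φ x) := by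
    refine integral_congr_ae ?_
    filter_upwards [Lp.coeFn_smul c F] with x hx
    rw [hx, Pi.smul_apply, PiLp.smul_apply, smul_eq_mul, mul_assoc]
  rw [e1, e2, integral_const_mul, integral_const_mul, hu φ k, mul_neg]

/-- The space of pairs `(u, ∇u)` in `L²(Ω) × L²(Ω; ℝᵈ)`. -/
def gradientGraph (Ω : TopologicalSpace.Opens (EuclideanSpace ℝ (Fin d))) :
    Submodule ℝ (WithLp 2 (L2 Ω × L2Field Ω)) where
  carrier := {p | IsWeakGradient Ω p.fst p.snd}
  zero_mem' := IsWeakGradient.zero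
  add_mem' hp hq := IsWeakGradient.add hp hq
  smul_mem' c _ hp := IsWeakGradient.smul c hp

/-- The Sobolev space `H¹(Ω)`, realised as the space of pairs `(u, ∇u)` in
`L²(Ω) × L²(Ω; ℝᵈ)`; the norm it inherits is `‖u‖² = ∫ |u|² + ∫ |∇u|²`. -/
def H1 (Ω : TopologicalSpace.Opens (EuclideanSpace ℝ (Fin d))) : Type := gradientGraph Ω

instance : NormedAddCommGroup (H1 Ω) := inferInstanceAs (NormedAddCommGroup (gradientGraph Ω))

instance : InnerProductSpace ℝ (H1 Ω) := inferInstanceAs (InnerProductSpace ℝ (gradientGraph Ω))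

/-- The embedding `H¹(Ω) → L²(Ω)`. -/
def H1.toL2 (Ω : TopologicalSpace.Opens (EuclideanSpace ℝ (Fin d))) : H1 Ω →L[ℝ] L2 Ω :=
  (WithLp.fstL 2 ℝ (L2 Ω) (L2Field Ω)).comp (gradientGraph Ω).subtypeL

/-- The weak gradient `H¹(Ω) → L²(Ω; ℝᵈ)`. -/
def H1.grad (Ω : TopologicalSpace.Opens (EuclideanSpace ℝ (Fin d))) : H1 Ω →L[ℝ] L2Field Ω :=
  (WithLp.sndL 2 ℝ (L2 Ω) (L2Field Ω)).comp (gradientGraph Ω).subtypeL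

/-- The weak partial derivative `∂ₖ u` of `u ∈ H¹(Ω)`. -/
def H1.partialDeriv (k : Fin d) (u : H1 Ω) (x : EuclideanSpace ℝ (Fin d)) : ℝ :=
  H1.grad Ω u x k

/-- The image of `C_c^∞(Ω)` in `H¹(Ω)`. -/
def testSubmodule (Ω : TopologicalSpace.Opens (EuclideanSpace ℝ (Fin d))) :
    Submodule ℝ (H1 Ω) where
  carrier := {u | ∃ φ : 𝓓(Ω, ℝ),
    H1.toL2 Ω u =ᵐ[volume.restrict (Ω : Set (EuclideanSpace ℝ (Fin d)))] φ}
  zero_mem' := ⟨0, by rw [map_zero]; exact Lp.coeFn_zero _ _ _⟩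
  add_mem' := by
    rintro u v ⟨φ, hφ⟩ ⟨ψ, hψ⟩
    refine ⟨φ + ψ, ?_⟩
    rw [map_add]
    exact (Lp.coeFn_add _ _).trans (hφ.add hψ)
  smul_mem' := by
    rintro c u ⟨φ, hφ⟩
    refine ⟨c • φ, ?_⟩
    rw [map_smul]
    exact (Lp.coeFn_smul _ _).trans (hφ.const_smul c)

/-- The space `H¹₀(Ω)`: the closure of `C_c^∞(Ω)` in `H¹(Ω)`. -/
def H10 (Ω : TopologicalSpace.Opens (EuclideanSpace ℝ (Fin d))) : Submodule ℝ (H1 Ω) :=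
  (testSubmodule Ω).topologicalClosure

/-- The embedding `H¹₀(Ω) → L²(Ω)`. -/
def H10.toL2 (Ω : TopologicalSpace.Opens (EuclideanSpace ℝ (Fin d))) : H10 Ω →L[ℝ] L2 Ω :=
  (H1.toL2 Ω).comp (H10 Ω).subtypeL

/-- The form `𝔞(t,u,v) = ∑_{k,j} ∫_Ω a_{kj}(t,x) ∂ₖu ∂ⱼv dx` on `H¹(Ω)`. -/
def ellipticForm (a : Fin d → Fin d → ℝ → EuclideanSpace ℝ (Fin d) → ℝ)
    (t : ℝ) (u v : H1 Ω) : ℝ :=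
  ∑ k, ∑ j, ∫ x in Ω, a k j t x * H1.partialDeriv k u x * H1.partialDeriv j v x

/-- `u` solves the Cauchy problem with respect to `V = H¹(Ω)` (Neumann boundary conditions). -/
def IsNeumannSolution (T : ℝ) (a : Fin d → Fin d → ℝ → EuclideanSpace ℝ (Fin d) → ℝ)
    (f : ℝ → StrongDual ℝ (H1 Ω)) (u₀ : L2 Ω) (u : ℝ → L2 Ω) : Prop :=
  IsSolution (H1.toL2 Ω) T (fun t v w => ellipticForm a t v w) f u₀ u

/-- `u` solves the Cauchy problem with respect to `V = H¹₀(Ω)` (Dirichlet boundary conditions);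
the functionals `f(t)` are restricted to `H¹₀(Ω)`. -/
def IsDirichletSolution (T : ℝ) (a : Fin d → Fin d → ℝ → EuclideanSpace ℝ (Fin d) → ℝ)
    (f : ℝ → StrongDual ℝ (H1 Ω)) (u₀ : L2 Ω) (u : ℝ → L2 Ω) : Prop :=
  IsSolution (H10.toL2 Ω) T (fun t (v w : H10 Ω) => ellipticForm a t (v : H1 Ω) (w : H1 Ω))
    (fun t => (f t).comp (H10 Ω).subtypeL) u₀ u

end Sobolev

end ParabolicForms

end

/-! The proof is an energy argument with positive parts: if `z' = g` in `V'`, `z(0) ≤ 0` and `⟨g(t),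
z(t)⁺⟩ ≤ 0` for a.e. `t`, then `‖z(t)⁺‖²` never exceeds its initial value, which is zero, and so
`z(t) ≤ 0`. It is applied to `z = -u` for each boundary condition, and then to `z = uD - uN`.

The sign of `⟨g, z⁺⟩` comes from the form. The weak gradient of `u⁺` is `θ ∇u` with `θ ≥ 0`, so
`𝔞(t, u, u⁺) = ∫ θ ∑ a_{kj} ∂ₖu ∂ⱼu ≥ 0` (`H1.ellipticForm_posPart_nonneg` in the namespace
`IsAccretiveAt` plays this role). The forcing term has a favourable sign for `-u` and cancels for
`uD - uN`.

The positive part must also be an admissible test function. For Dirichlet conditions this rests on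
the ideal property of `H¹₀(Ω)`, `mem_H10_of_le_abs`: once `uN ≥ 0` is known, `0 ≤ (uD - uN)⁺ ≤
|uD|`, hence `(uD - uN)⁺ ∈ H¹₀(Ω)`. The difference `uD - uN` itself need not lie in `H¹₀(Ω)`, and
its equation is only available when tested on `H¹₀(Ω)`. For this reason `le_initial_of_subgradient`
asks for a lift to `V` of the subgradient `z⁺` only, not of `z`, and replaces the chain rule for
`½‖z⁺‖²` by the convexity inequality applied to backward differences in time. -/

noncomputable section
namespace ParabolicForms

open scoped ContDiff Convolution
open ContinuousLinearMap (lsmul)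

/-! ### Weak derivatives in time -/

/-- A smooth compactly supported function on the line with support in `(0, T)`, as a bundled
test function. -/
def mkTimeTest {T : ℝ} (φ : ℝ → ℝ) (h₁ : ContDiff ℝ ∞ φ) (h₂ : HasCompactSupport φ)
    (h₃ : tsupport φ ⊆ Ioo 0 T) : 𝓓(timeInterval T, ℝ) :=
  ⟨φ, by simpa using h₁, h₂, h₃⟩

lemma exists_Icc_of_isCompact_subset_Ioo {T : ℝ} (hT : 0 < T) {K : Set ℝ} (hK : IsCompact K)
    (h : K ⊆ Ioo 0 T) : ∃ a b, 0 < a ∧ a ≤ b ∧ b < T ∧ K ⊆ Icc a b := by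
  have hm : T / 2 ∈ Ioo 0 T := ⟨by linarith, by linarith⟩
  have hc : IsCompact (insert (T / 2) K) := hK.insert _
  have hsub : insert (T / 2) K ⊆ Ioo 0 T := insert_subset hm h
  obtain ⟨a, ha, ha'⟩ := hc.exists_isLeast ⟨_, mem_insert _ _⟩
  obtain ⟨b, hb, hb'⟩ := hc.exists_isGreatest ⟨_, mem_insert _ _⟩
  exact ⟨a, b, (hsub ha).1, ha' hb, (hsub hb).2,
    fun x hx => ⟨ha' (mem_insert_of_mem _ hx), hb' (mem_insert_of_mem _ hx)⟩⟩

/-- A smooth function with support in `(0, T)` and vanishing integral has a primitive of the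
same kind. -/
lemma exists_primitive_testFunction {T : ℝ} (hT : 0 < T) {θ : ℝ → ℝ} (h₁ : ContDiff ℝ ∞ θ)
    (h₂ : HasCompactSupport θ) (h₃ : tsupport θ ⊆ Ioo 0 T) (h₀ : ∫ x, θ x = 0) :
    ∃ φ : 𝓓(timeInterval T, ℝ), ∀ x, deriv φ x = θ x := by
  obtain ⟨a, b, ha, hab, hb, hK⟩ := exists_Icc_of_isCompact_subset_Ioo hT h₂ h₃
  have hz : ∀ x, x ∉ Icc a b → θ x = 0 := fun x hx =>
    image_eq_zero_of_notMem_tsupport fun h => hx (hK h)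
  have hd : ∀ x, HasDerivAt (fun y => ∫ s in (0 : ℝ)..y, θ s) (θ x) x := fun x =>
    (h₁.continuous.integral_hasStrictDerivAt 0 x).hasDerivAt
  have hint : ∀ x y, IntervalIntegrable θ volume x y := fun x y =>
    h₁.continuous.intervalIntegrable x y
  -- To the left of the support the primitive has not started to grow; to the right it equals the
  -- total integral, which is zero.
  have hout : ∀ x, x ∉ Icc a b → ∫ s in (0 : ℝ)..x, θ s = 0 := by
    intro x hx
    rw [mem_Icc, not_and_or, not_le, not_le] at hx
    rcases hx with hx | hx
    · refine intervalIntegral.integral_zero_ae (.of_forall fun s hs => hz s fun h => ?_)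
      have := (uIoc_subset_uIcc hs).2
      have h' := h.1
      rcases le_sup_iff.1 this with h'' | h'' <;> linarith
    · rw [← h₀, intervalIntegral.integral_of_le (by linarith)]
      refine setIntegral_eq_integral_of_forall_compl_eq_zero fun s hs => hz s fun h => hs ?_
      exact ⟨by linarith [h.1], by linarith [h.2]⟩
  have hsupp : tsupport (fun y => ∫ s in (0 : ℝ)..y, θ s) ⊆ Icc a b := by
    refine closure_minimal (fun x hx => ?_) isClosed_Icc
    by_contra h
    exact hx (hout x h)
  refine ⟨mkTimeTest (fun y => ∫ s in (0 : ℝ)..y, θ s) ?_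
    (HasCompactSupport.of_support_subset_isCompact isCompact_Icc ((subset_tsupport _).trans hsupp))
    (hsupp.trans fun x hx => ⟨by linarith [hx.1], by linarith [hx.2]⟩), fun x => (hd x).deriv⟩
  rw [contDiff_infty_iff_deriv]
  refine ⟨fun x => (hd x).differentiableAt, ?_⟩
  rwa [show deriv (fun y => ∫ s in (0 : ℝ)..y, θ s) = θ from funext fun x => (hd x).deriv]

/-- The du Bois-Reymond lemma for continuous functions. -/
lemma eq_of_forall_integral_deriv_mul_eq_zero {T : ℝ} (hT : 0 < T) {c : ℝ → ℝ}
    (hc : ContinuousOn c (Icc 0 T))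
    (h : ∀ φ : 𝓓(timeInterval T, ℝ), ∫ s in Ioo 0 T, deriv φ s * c s = 0) :
    ∃ κ, ∀ t ∈ Icc 0 T, c t = κ := by
  have hcI : IntegrableOn c (Ioo 0 T) :=
    (hc.integrableOn_compact isCompact_Icc).mono_set Ioo_subset_Icc_self
  let B : ContDiffBump (T / 2) := ⟨T / 8, T / 4, by linarith, by linarith⟩
  set ρ := B.normed volume with hρ
  have hρ1 : ContDiff ℝ ∞ ρ := B.contDiff_normed
  have hρ2 : HasCompactSupport ρ := B.hasCompactSupport_normed
  have hρ3 : tsupport ρ ⊆ Ioo 0 T := by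
    rw [hρ, B.tsupport_normed_eq, Real.closedBall_eq_Icc]
    intro x hx
    have h1 : T / 2 - T / 4 ≤ x := hx.1
    have h2 : x ≤ T / 2 + T / 4 := hx.2
    exact ⟨by linarith, by linarith⟩
  have hmul : ∀ ψ : ℝ → ℝ, Continuous ψ → HasCompactSupport ψ →
      IntegrableOn (fun s => ψ s * c s) (Ioo 0 T) := by
    intro ψ h1 h2
    obtain ⟨C, hC⟩ := h1.bounded_above_of_compact_support h2
    exact hcI.bdd_mul h1.aestronglyMeasurable (.of_forall hC)
  set κ := ∫ s in Ioo 0 T, ρ s * c s with hκ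
  have key : ∀ᵐ x, x ∈ Ioo 0 T → c x - κ = 0 := by
    refine isOpen_Ioo.ae_eq_zero_of_integral_contDiff_smul_eq_zero
      (IntegrableOn.locallyIntegrableOn (hcI.sub (integrableOn_const (by simp)))) ?_
    intro ψ h1 h2 h3
    have hψI : Integrable ψ := h1.continuous.integrable_of_hasCompactSupport h2
    have hρI : Integrable ρ := hρ1.continuous.integrable_of_hasCompactSupport hρ2
    -- Subtracting the multiple `∫ ψ` of the unit-mass bump `ρ` makes the integral vanish, so the
    -- difference is the derivative of a test function. The constant `κ` is therefore the
    -- `ρ`-average of `c`.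
    obtain ⟨φ, hφ⟩ := exists_primitive_testFunction hT (θ := fun x => ψ x - (∫ y, ψ y) * ρ x)
      (h1.sub (contDiff_const.mul hρ1)) (h2.sub (hρ2.mul_left))
      ((tsupport_sub _ _).trans (union_subset h3 ((tsupport_mul_subset_right).trans hρ3)))
      (by rw [integral_sub hψI (hρI.const_mul _), integral_const_mul, B.integral_normed]; ring)
    have h4 := h φ
    simp only [hφ] at h4
    have h5 : ∫ x, ψ x • (c x - κ) = ∫ x in Ioo 0 T, ψ x * (c x - κ) := by
      refine (setIntegral_eq_integral_of_forall_compl_eq_zero fun s hs => ?_).symm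
      rw [image_eq_zero_of_notMem_tsupport fun h => hs (h3 h), zero_smul]
    have h6 : ∫ x in Ioo 0 T, ψ x = ∫ x, ψ x :=
      setIntegral_eq_integral_of_forall_compl_eq_zero fun s hs =>
        image_eq_zero_of_notMem_tsupport fun h => hs (h3 h)
    rw [h5]
    simp only [mul_sub]
    rw [integral_sub (hmul ψ h1.continuous h2) (hψI.integrableOn.mul_const _), integral_mul_const,
      h6]
    simp only [sub_mul, mul_assoc] at h4
    rw [integral_sub (hmul ψ h1.continuous h2) ((hmul ρ hρ1.continuous hρ2).const_mul _),
      integral_const_mul] at h4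
    exact h4
  refine ⟨κ, ?_⟩
  have h1 : EqOn c (fun _ => κ) (Ioo 0 T) := by
    refine Measure.eqOn_Ioo_of_ae_eq (μ := volume) ?_ (hc.mono Ioo_subset_Icc_self)
      continuousOn_const
    filter_upwards [(ae_restrict_iff' measurableSet_Ioo).2 key] with x hx
    linarith
  have h2 := EqOn.of_subset_closure h1 hc continuousOn_const Ioo_subset_Icc_self
    (by rw [closure_Ioo hT.ne])
  exact h2

/-- A continuous function with integrable weak derivative is the primitive of the latter. -/
lemma sub_eq_integral_of_weakDeriv {T : ℝ} (hT : 0 < T) {u g : ℝ → ℝ}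
    (hu : ContinuousOn u (Icc 0 T)) (hg : IntegrableOn g (Ioo 0 T))
    (h : ∀ φ : 𝓓(timeInterval T, ℝ),
      -∫ s in Ioo 0 T, deriv φ s * u s = ∫ s in Ioo 0 T, φ s * g s) :
    ∀ s ∈ Icc 0 T, ∀ t ∈ Icc 0 T, u t - u s = ∫ r in s..t, g r := by
  have hgi : IntervalIntegrable g volume 0 T := by
    rwa [intervalIntegrable_iff_integrableOn_Ioo_of_le hT.le]
  have hP := hgi.absolutelyContinuousOnInterval_intervalIntegral (c := 0) (by simp)
  have hPc : ContinuousOn (fun x => ∫ r in (0 : ℝ)..x, g r) (Icc 0 T) := by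
    simpa [uIcc_of_le hT.le] using hP.continuousOn
  have hsub : ∀ t ∈ Icc 0 T, IntervalIntegrable g volume 0 t := fun t ht =>
    hgi.mono_set (by rw [uIcc_of_le ht.1, uIcc_of_le hT.le]; exact Icc_subset_Icc_right ht.2)
  have hint : ∀ {f : ℝ → ℝ}, ∫ s in Ioo 0 T, f s = ∫ s in (0 : ℝ)..T, f s := by
    intro f
    rw [intervalIntegral.integral_of_le hT.le, integral_Ioc_eq_integral_Ioo]
  -- The function `u` minus the primitive of `g` has zero weak derivative. As `g` is merely
  -- integrable, its primitive is only absolutely continuous, and integration by parts is used in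
  -- that class.
  obtain ⟨κ, hκ⟩ := eq_of_forall_integral_deriv_mul_eq_zero hT (hu.sub hPc) (by
    intro φ
    have hφ1 : ContDiff ℝ 1 φ := φ.contDiff.of_le (by simp)
    have hφ' : Continuous (deriv φ) := hφ1.continuous_deriv le_rfl
    have hφL : ∃ C, LipschitzWith C φ :=
      hφ1.lipschitzWith_of_hasCompactSupport φ.hasCompactSupport (by simp)
    obtain ⟨C, hC⟩ := hφL
    have hφA : AbsolutelyContinuousOnInterval φ 0 T := hC.lipschitzOnWith.absolutelyContinuousOnInterval
    have h0 : φ 0 = 0 := image_eq_zero_of_notMem_tsupport fun h => lt_irrefl _ (φ.tsupport_subset h).1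
    have h1 : φ T = 0 := image_eq_zero_of_notMem_tsupport fun h => lt_irrefl _ (φ.tsupport_subset h).2
    have hparts := hφA.integral_mul_deriv_eq_deriv_mul hP
    have hd : ∫ x in (0 : ℝ)..T, φ x * deriv (fun x => ∫ r in (0 : ℝ)..x, g r) x
        = ∫ x in (0 : ℝ)..T, φ x * g x := by
      refine intervalIntegral.integral_congr_ae ?_
      filter_upwards [hgi.ae_hasDerivAt_integral] with x hx hxT
      rw [(hx (uIoc_subset_uIcc hxT) 0 (by simp)).deriv]
    have hφu := h φ
    rw [hd, h0, h1] at hparts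
    rw [hint, hint, hparts] at hφu
    simp only [Pi.sub_apply, mul_sub]
    rw [hint, intervalIntegral.integral_sub]
    · linarith
    · refine ContinuousOn.intervalIntegrable ?_
      rw [uIcc_of_le hT.le]
      exact hφ'.continuousOn.mul hu
    · refine ContinuousOn.intervalIntegrable ?_
      rw [uIcc_of_le hT.le]
      exact hφ'.continuousOn.mul hPc)
  intro s hs t ht
  have h1 := hκ s hs
  have h2 := hκ t ht
  simp only [Pi.sub_apply] at h1 h2
  rw [← intervalIntegral.integral_interval_sub_left (hsub t ht) (hsub s hs)]
  linarith

section Abstract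

variable {V H : Type*} [NormedAddCommGroup V] [InnerProductSpace ℝ V]
  [NormedAddCommGroup H] [InnerProductSpace ℝ H]

/-- Testing with a fixed `w` reduces the `V'`-valued weak derivative to a scalar one. This
integrated identity, valid at all pairs of times for the continuous representative, is the form in
which the weak derivative enters the energy argument. -/
lemma MaxReg.inner_sub_eq_integral {j : V →L[ℝ] H} {T : ℝ} (hT : 0 < T) {v : ℝ → V}
    {dv : ℝ → StrongDual ℝ V} (hv : MaxReg j T v dv) {u : ℝ → H} (hu : ContinuousOn u (Icc 0 T))
    (huv : ∀ᵐ t ∂(timeMeasure T), u t = j (v t)) (w : V) :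
    ∀ s ∈ Icc 0 T, ∀ t ∈ Icc 0 T, ⟪u t - u s, j w⟫_ℝ = ∫ r in s..t, dv r w := by
  have hdv : Integrable dv (timeMeasure T) := hv.memLp_deriv.integrable (by norm_num)
  have hvI : Integrable v (timeMeasure T) := hv.memLp.integrable (by norm_num)
  -- `toDual j` as a bounded linear map, so that it preserves integrability.
  let Λ : V →L[ℝ] StrongDual ℝ V :=
    ((ContinuousLinearMap.compL ℝ V H ℝ).flip j).comp ((innerSL ℝ).comp j)
  have hΛ : ∀ x, toDual j x = Λ x := fun x => by ext y; simp [toDual, Λ]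
  have hjv : Integrable (fun t => toDual j (v t)) (timeMeasure T) := by
    simp only [hΛ]
    exact Λ.integrable_comp hvI
  have key := sub_eq_integral_of_weakDeriv hT (u := fun t => ⟪u t, j w⟫_ℝ) (g := fun t => dv t w)
    (hu.inner continuousOn_const) (hdv.apply_continuousLinearMap w) (by
      intro φ
      have h1 := congrArg (fun L : StrongDual ℝ V => L w) (hv.weakDerivative φ)
      have hb : ∀ ψ : ℝ → ℝ, Continuous ψ → HasCompactSupport ψ →
          ∀ F : ℝ → StrongDual ℝ V, Integrable F (timeMeasure T) →
          (∫ s, ψ s • F s ∂(timeMeasure T)) w = ∫ s, ψ s * F s w ∂(timeMeasure T) := by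
        intro ψ h1 h2 F hF
        obtain ⟨C, hC⟩ := h1.bounded_above_of_compact_support h2
        have hI : Integrable (fun s => ψ s • F s) (timeMeasure T) :=
          hF.bdd_smul C h1.aestronglyMeasurable (.of_forall hC)
        rw [ContinuousLinearMap.integral_apply hI]
        simp
      simp only [neg_apply] at h1
      have hφ1 : ContDiff ℝ 1 φ := φ.contDiff.of_le (by simp)
      rw [hb _ (hφ1.continuous_deriv le_rfl) φ.hasCompactSupport.deriv _ hjv,
        hb _ φ.continuous φ.hasCompactSupport _ hdv] at h1
      rw [← h1]
      congr 1
      refine integral_congr_ae ?_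
      filter_upwards [huv] with t ht
      simp [ht, toDual])
  intro s hs t ht
  rw [inner_sub_left, key s hs t ht]

/-! ### Monotonicity along a subgradient -/

/-- Integrating the backward difference over `(h, b)` leaves only the integrals of `F` over the two
end intervals. The double integral of `k` is handled by the same identity for its primitive `E`:
since `E` is nonnegative and nondecreasing, the end terms are at most `h * E b`. After division by
`h` this is an integrated growth bound that needs only continuity of `F`. -/
lemma integral_le_of_shift_le {b h : ℝ} (hh : 0 < h) (hhb : h < b) {F k l : ℝ → ℝ}
    (hF : ContinuousOn F (Icc 0 b)) (hk : IntegrableOn k (Ioo 0 b)) (hk0 : ∀ x, 0 ≤ k x)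
    (hl : IntegrableOn l (Ioo 0 b)) (hl0 : ∀ᵐ x ∂(volume.restrict (Ioo 0 b)), 0 ≤ l x)
    (hle : ∀ᵐ τ ∂(volume.restrict (Ioo h b)),
      F τ - F (τ - h) ≤ (∫ s in (τ - h)..τ, k s) + h * l τ) :
    (∫ τ in (b - h)..b, F τ) - ∫ τ in (0 : ℝ)..h, F τ
      ≤ h * ((∫ s in (0 : ℝ)..b, k s) + ∫ s in (0 : ℝ)..b, l s) := by
  have hb : 0 < b := hh.trans hhb
  have hki : IntervalIntegrable k volume 0 b := by
    rwa [intervalIntegrable_iff_integrableOn_Ioo_of_le hb.le]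
  have hli : IntervalIntegrable l volume 0 b := by
    rwa [intervalIntegrable_iff_integrableOn_Ioo_of_le hb.le]
  have shift : ∀ G : ℝ → ℝ, ContinuousOn G (Icc 0 b) →
      IntervalIntegrable (fun τ => G τ - G (τ - h)) volume h b ∧
      ∫ τ in h..b, (G τ - G (τ - h)) = (∫ τ in (b - h)..b, G τ) - ∫ τ in (0 : ℝ)..h, G τ := by
    intro G hG
    have hi : ∀ x ∈ Icc 0 b, ∀ y ∈ Icc 0 b, IntervalIntegrable G volume x y := fun x hx y hy =>
      (hG.mono (uIcc_subset_Icc hx hy)).intervalIntegrable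
    have h1 : IntervalIntegrable G volume h b := hi h ⟨hh.le, hhb.le⟩ b ⟨hb.le, le_rfl⟩
    have h2 : IntervalIntegrable G volume 0 (b - h) :=
      hi 0 ⟨le_rfl, hb.le⟩ (b - h) ⟨by linarith, by linarith⟩
    have h3 : IntervalIntegrable (fun τ => G (τ - h)) volume h b := by
      simpa using h2.comp_sub_right h
    refine ⟨h1.sub h3, ?_⟩
    rw [intervalIntegral.integral_sub h1 h3, intervalIntegral.integral_comp_sub_right, sub_self]
    have e1 := intervalIntegral.integral_add_adjacent_intervals
      (hi 0 ⟨le_rfl, hb.le⟩ h ⟨hh.le, hhb.le⟩) h1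
    have e2 := intervalIntegral.integral_add_adjacent_intervals
      h2 (hi (b - h) ⟨by linarith, by linarith⟩ b ⟨hb.le, le_rfl⟩)
    linarith
  set E := fun τ => ∫ s in (0 : ℝ)..τ, k s with hE
  have hEc : ContinuousOn E (Icc 0 b) := by
    simpa [uIcc_of_le hb.le] using
      (hki.absolutelyContinuousOnInterval_intervalIntegral (c := 0) (by simp)).continuousOn
  have hks : ∀ t ∈ Icc 0 b, IntervalIntegrable k volume 0 t := fun t ht =>
    hki.mono_set (by rw [uIcc_of_le ht.1, uIcc_of_le hb.le]; exact Icc_subset_Icc_right ht.2)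
  obtain ⟨f1, f2⟩ := shift F hF
  obtain ⟨e1, e2⟩ := shift E hEc
  have hlh : IntervalIntegrable l volume h b :=
    hli.mono_set (by
      rw [uIcc_of_le hhb.le, uIcc_of_le hb.le]; exact Icc_subset_Icc_left hh.le)
  have hmono : ∫ τ in h..b, (F τ - F (τ - h)) ≤ ∫ τ in h..b, ((E τ - E (τ - h)) + h * l τ) := by
    refine intervalIntegral.integral_mono_ae_restrict hhb.le f1 (e1.add (hlh.const_mul h)) ?_
    rw [← restrict_Ioo_eq_restrict_Icc]
    filter_upwards [hle, ae_restrict_mem measurableSet_Ioo] with τ h1 h2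
    have : E τ - E (τ - h) = ∫ s in (τ - h)..τ, k s :=
      intervalIntegral.integral_interval_sub_left (hks τ ⟨by linarith [h2.1], h2.2.le⟩)
        (hks (τ - h) ⟨by linarith [h2.1], by linarith [h2.2]⟩)
    rw [this]
    exact h1
  rw [intervalIntegral.integral_add e1 (hlh.const_mul h), intervalIntegral.integral_const_mul, f2, e2]
    at hmono
  have hE0 : 0 ≤ ∫ τ in (0 : ℝ)..h, E τ := by
    refine intervalIntegral.integral_nonneg hh.le fun τ hτ => ?_
    exact intervalIntegral.integral_nonneg hτ.1 fun s _ => hk0 s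
  have hEb : ∫ τ in (b - h)..b, E τ ≤ h * E b := by
    have : ∫ τ in (b - h)..b, E τ ≤ ∫ _ in (b - h)..b, E b := by
      refine intervalIntegral.integral_mono_on (by linarith)
        ((hEc.mono (uIcc_subset_Icc ⟨by linarith, by linarith⟩
          ⟨hb.le, le_rfl⟩)).intervalIntegrable) (by simp) fun τ hτ => ?_
      have hτ0 : 0 ≤ τ := by linarith [hτ.1]
      have := intervalIntegral.integral_interval_sub_left (hks b ⟨hb.le, le_rfl⟩)
        (hks τ ⟨hτ0, hτ.2⟩)
      have h' : 0 ≤ ∫ s in τ..b, k s :=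
        intervalIntegral.integral_nonneg hτ.2 fun s _ => hk0 s
      simp only [hE]
      linarith
    simpa using this
  have hlb : ∫ τ in h..b, l τ ≤ ∫ τ in (0 : ℝ)..b, l τ := by
    refine intervalIntegral.integral_mono_interval hh.le hhb.le le_rfl ?_ hli
    rwa [restrict_Ioc_eq_restrict_Icc, ← restrict_Ioo_eq_restrict_Icc]
  have := mul_le_mul_of_nonneg_left hlb hh.le
  simp only [hE] at hEb hE0 hmono
  linarith

end Abstract

section Abstract

variable {V H : Type*} [NormedAddCommGroup V] [InnerProductSpace ℝ V]
  [NormedAddCommGroup H] [InnerProductSpace ℝ H]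

/-- Square integrable functions are close in `L²` to uniformly continuous ones. -/
lemma exists_uniformContinuous_integral_sq_le {X : Type*} [NormedAddCommGroup X] [NormedSpace ℝ X]
    {T : ℝ} {g : ℝ → X} (hg : MemLp g 2 (timeMeasure T)) {δ : ℝ} (hδ : 0 < δ) :
    ∃ c : ℝ → X, UniformContinuous c ∧ MemLp (fun s => g s - c s) 2 (timeMeasure T) ∧
      ∫ s, ‖g s - c s‖ ^ 2 ∂(timeMeasure T) ≤ δ := by
  obtain ⟨c, h1, h2, h3, h4⟩ := (show MemLp g (ENNReal.ofReal 2) (timeMeasure T) by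
    simpa using hg).exists_hasCompactSupport_integral_rpow_sub_le (p := 2) (by norm_num) hδ
  refine ⟨c, h3.uniformContinuous_of_tendsto_cocompact h1.is_zero_at_infty, hg.sub (by simpa using h4), ?_⟩
  simpa using h2

/-- If `Φ` is convex with subgradient `P`, and `z' = g` in the sense of `V'` with
`⟨g(t), P(z(t))⟩ ≤ 0`, then `Φ(z(t)) ≤ Φ(z(0))`. -/
theorem le_initial_of_subgradient {j : V →L[ℝ] H} {T : ℝ} {z : ℝ → H}
    (hz : ContinuousOn z (Icc 0 T)) {g : ℝ → StrongDual ℝ V} (hg : MemLp g 2 (timeMeasure T))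
    (hzg : ∀ w, ∀ s ∈ Icc 0 T, ∀ t ∈ Icc 0 T, ⟪z t - z s, j w⟫_ℝ = ∫ r in s..t, g r w)
    {m : ℝ → ℝ} (hm : MemLp m 2 (timeMeasure T)) {Φ : H → ℝ} (hΦ : Continuous Φ) {P : H → H}
    (hP : ∀ x y, Φ y - Φ x ≤ ⟪y - x, P y⟫_ℝ)
    (hw : ∀ᵐ t ∂(timeMeasure T), ∃ w : V, j w = P (z t) ∧ ‖w‖ ≤ m t ∧ g t w ≤ 0) :
    ∀ t ∈ Icc 0 T, Φ (z t) ≤ Φ (z 0) := by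
  intro b hb
  rcases hb.1.eq_or_lt with rfl | hb0
  · exact le_rfl
  have hsub : Ioo 0 b ⊆ Ioo 0 T := Ioo_subset_Ioo_right hb.2
  have hmI : IntegrableOn m (Ioo 0 T) := hm.integrable (by norm_num)
  have hm2 : IntegrableOn (fun t => m t ^ 2) (Ioo 0 T) := hm.integrable_sq
  set F := fun t => Φ (z t) with hFdef
  have hF : ContinuousOn F (Icc 0 b) :=
    (hΦ.comp_continuousOn hz).mono (Icc_subset_Icc_right hb.2)
  set C := 1 + ∫ t in Ioo 0 b, (m t ^ 2 + m t) with hC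
  -- `C` does not depend on `δ`. Its summand `1` absorbs the two errors of approximating `g`, each
  -- at most `δ / 2`; the extra `2` pays for replacing the averages of `F` near `b` and `0` by its
  -- values there.
  suffices ∀ δ > 0, F b - F 0 ≤ δ * (C + 2) by
    have hlim : Filter.Tendsto (fun δ : ℝ => δ * (C + 2)) (nhdsWithin 0 (Ioi 0)) (nhds 0) := by
      have : Continuous fun δ : ℝ => δ * (C + 2) := by fun_prop
      simpa using (this.tendsto 0).mono_left nhdsWithin_le_nhds
    have := ge_of_tendsto hlim (Filter.eventually_of_mem self_mem_nhdsWithin this)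
    simp only [hFdef] at this ⊢
    linarith
  intro δ hδ
  -- The aim is to replace `g s` by `g τ` for `s` close to `τ`, which a uniformly continuous `c`
  -- permits. The squared error `δ ^ 2` outweighs the factor `1 / (2 * δ)` that Young's inequality
  -- produces in `k`.
  obtain ⟨c, hc, he, heδ⟩ := exists_uniformContinuous_integral_sq_le hg (δ := δ ^ 2) (by positivity)
  set k : ℝ → ℝ := fun s => ‖g s - c s‖ ^ 2 / (2 * δ) with hk
  set l : ℝ → ℝ := fun s => k s + δ * (m s ^ 2 + m s) with hl
  have hk0 : ∀ s, 0 ≤ k s := fun s => by positivity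
  have he2 : IntegrableOn (fun s => ‖g s - c s‖ ^ 2) (Ioo 0 T) := he.norm.integrable_sq
  have hkT : IntegrableOn k (Ioo 0 T) := he2.div_const _
  have hkI : IntegrableOn k (Ioo 0 b) := hkT.mono_set hsub
  have hmm : IntegrableOn (fun s => m s ^ 2 + m s) (Ioo 0 b) := (hm2.add hmI).mono_set hsub
  have hlI : IntegrableOn l (Ioo 0 b) := hkI.add (hmm.const_mul _)
  have hkint : ∫ s in Ioo 0 b, k s ≤ δ / 2 := by
    calc ∫ s in Ioo 0 b, k s ≤ ∫ s in Ioo 0 T, k s :=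
          setIntegral_mono_set hkT (.of_forall hk0) (Filter.Eventually.of_forall hsub)
      _ = (∫ s in Ioo 0 T, ‖g s - c s‖ ^ 2) / (2 * δ) := integral_div _ _
      _ ≤ δ ^ 2 / (2 * δ) := by gcongr
      _ = δ / 2 := by field_simp
  have hio : ∀ {f : ℝ → ℝ}, ∫ s in (0 : ℝ)..b, f s = ∫ s in Ioo 0 b, f s := by
    intro f
    rw [intervalIntegral.integral_of_le hb0.le, integral_Ioc_eq_integral_Ioo]
  have htot : (∫ s in (0 : ℝ)..b, k s) + ∫ s in (0 : ℝ)..b, l s ≤ δ * C := by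
    rw [hio, hio]
    simp only [hl]
    rw [integral_add hkI (hmm.const_mul _), integral_const_mul]
    simp only [hC]
    linarith
  have hwb : ∀ᵐ t ∂(volume.restrict (Ioo 0 b)),
      ∃ w : V, j w = P (z t) ∧ ‖w‖ ≤ m t ∧ g t w ≤ 0 := ae_restrict_of_ae_restrict_of_subset hsub hw
  have hl0 : ∀ᵐ x ∂(volume.restrict (Ioo 0 b)), 0 ≤ l x := by
    filter_upwards [hwb] with t ⟨w, _, h2, _⟩
    have : 0 ≤ m t := (norm_nonneg w).trans h2
    simp only [hl]
    have := hk0 t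
    positivity
  obtain ⟨h₀, hh₀, hch⟩ := Metric.uniformContinuous_iff.1 hc δ hδ
  have hFb : ∀ᶠ x in nhdsWithin b (Icc 0 b), F b - δ < F x :=
    (hF b ⟨hb0.le, le_rfl⟩).eventually (lt_mem_nhds (by linarith))
  have hF0 : ∀ᶠ x in nhdsWithin 0 (Icc 0 b), F x < F 0 + δ :=
    (hF 0 ⟨le_rfl, hb0.le⟩).eventually (gt_mem_nhds (by linarith))
  obtain ⟨r₁, hr₁, hF₁⟩ := Metric.mem_nhdsWithin_iff.1 hFb
  obtain ⟨r₂, hr₂, hF₂⟩ := Metric.mem_nhdsWithin_iff.1 hF0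
  -- The step `h` is below the modulus `h₀` of `c`, the length `b`, and the radii on which `F` is
  -- within `δ` of its bounds at `b` and at `0`.
  obtain ⟨h, hh, hhlt⟩ := exists_between (show 0 < min (min h₀ b) (min r₁ r₂) by positivity)
  simp only [lt_min_iff] at hhlt
  obtain ⟨⟨hhh₀, hhb⟩, hhr₁, hhr₂⟩ := hhlt
  have main := integral_le_of_shift_le hh hhb hF hkI hk0 hlI hl0 (by
    have h1 : ∀ᵐ t ∂(volume.restrict (Ioo h b)),
        ∃ w : V, j w = P (z t) ∧ ‖w‖ ≤ m t ∧ g t w ≤ 0 :=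
      ae_restrict_of_ae_restrict_of_subset (Ioo_subset_Ioo_left hh.le) hwb
    filter_upwards [h1, ae_restrict_mem measurableSet_Ioo] with τ ⟨w, hw1, hw2, hw3⟩ hτ
    have hτT : τ ∈ Icc 0 T := ⟨by linarith [hτ.1], hτ.2.le.trans hb.2⟩
    have hτhT : τ - h ∈ Icc 0 T := ⟨by linarith [hτ.1], by linarith [hτ.2, hb.2]⟩
    have hm0 : 0 ≤ m τ := (norm_nonneg w).trans hw2
    have hii : ∀ f : ℝ → ℝ, IntegrableOn f (Ioo 0 T) → IntervalIntegrable f volume (τ - h) τ := by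
      intro f hf
      rw [intervalIntegrable_iff_integrableOn_Ioo_of_le (by linarith)]
      exact hf.mono_set (Ioo_subset_Ioo hτhT.1 hτT.2)
    have hgI : Integrable g (timeMeasure T) := hg.integrable (by norm_num)
    calc F τ - F (τ - h) ≤ ⟪z τ - z (τ - h), P (z τ)⟫_ℝ := hP _ _
      _ = ∫ s in (τ - h)..τ, g s w := by rw [← hw1, hzg w _ hτhT _ hτT]
      _ ≤ ∫ s in (τ - h)..τ, (k s + l τ) := by
        refine intervalIntegral.integral_mono_on (by linarith)
          (hii _ (hgI.apply_continuousLinearMap w)) ((hii _ hkT).add (by simp)) fun s hs => ?_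
        -- The last term is nonpositive by hypothesis and the second is at most `δ * m τ`. Young's
        -- inequality for the other two gives `k s + k τ + δ * m τ ^ 2`, so the sum is at most `k s
        -- + l τ`.
        have e1 : g s w = (g s - c s) w + (c s - c τ) w - (g τ - c τ) w + g τ w := by
          simp
        have b1 : (g s - c s) w ≤ ‖g s - c s‖ * m τ :=
          (le_abs_self _).trans (((g s - c s).le_opNorm w).trans (by gcongr))
        have b2 : (c s - c τ) w ≤ δ * m τ := by
          refine (le_abs_self _).trans (((c s - c τ).le_opNorm w).trans ?_)
          gcongr
          rw [← dist_eq_norm]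
          refine (hch ?_).le
          rw [Real.dist_eq, abs_lt]
          constructor <;> linarith [hs.1, hs.2]
        have b3 : -(g τ - c τ) w ≤ ‖g τ - c τ‖ * m τ :=
          (neg_le_abs _).trans (((g τ - c τ).le_opNorm w).trans (by gcongr))
        have young : ∀ x : ℝ, x * m τ ≤ x ^ 2 / (2 * δ) + δ * m τ ^ 2 / 2 := by
          intro x
          rw [← sub_nonneg]
          have : x ^ 2 / (2 * δ) + δ * m τ ^ 2 / 2 - x * m τ = (x - δ * m τ) ^ 2 / (2 * δ) := by
            field_simp
            ring
          rw [this]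
          positivity
        have y1 := young ‖g s - c s‖
        have y2 := young ‖g τ - c τ‖
        simp only [hl, hk]
        rw [e1]
        linarith
      _ = (∫ s in (τ - h)..τ, k s) + h * l τ := by
        rw [intervalIntegral.integral_add (hii _ hkT) (by simp)]
        simp)
  have hiF : ∀ x ∈ Icc 0 b, ∀ y ∈ Icc 0 b, IntervalIntegrable F volume x y := fun x hx y hy =>
    (hF.mono (uIcc_subset_Icc hx hy)).intervalIntegrable
  have lower : h * (F b - δ) ≤ ∫ τ in (b - h)..b, F τ := by
    have : ∫ _ in (b - h)..b, (F b - δ) ≤ ∫ τ in (b - h)..b, F τ :=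
      intervalIntegral.integral_mono_on (by linarith) (by simp)
        (hiF _ ⟨by linarith, by linarith⟩ _ ⟨hb0.le, le_rfl⟩) fun τ hτ =>
        (hF₁ ⟨by rw [Metric.mem_ball, Real.dist_eq, abs_lt]; constructor <;> linarith [hτ.1, hτ.2],
          ⟨by linarith [hτ.1], hτ.2⟩⟩).le
    rw [intervalIntegral.integral_const, smul_eq_mul, sub_sub_cancel] at this
    exact this
  have upper : ∫ τ in (0 : ℝ)..h, F τ ≤ h * (F 0 + δ) := by
    have : ∫ τ in (0 : ℝ)..h, F τ ≤ ∫ _ in (0 : ℝ)..h, (F 0 + δ) :=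
      intervalIntegral.integral_mono_on hh.le
        (hiF _ ⟨le_rfl, hb0.le⟩ _ ⟨hh.le, hhb.le⟩) (by simp) fun τ hτ =>
        (hF₂ ⟨by rw [Metric.mem_ball, Real.dist_eq, abs_lt]; constructor <;> linarith [hτ.1, hτ.2],
          ⟨hτ.1, by linarith [hτ.2]⟩⟩).le
    rw [intervalIntegral.integral_const, smul_eq_mul, sub_zero] at this
    exact this
  have h5 : h * (F b - δ) - h * (F 0 + δ) ≤ h * (δ * C) := by
    have := mul_le_mul_of_nonneg_left htot hh.le
    linarith
  have h6 : F b - δ - (F 0 + δ) ≤ δ * C := by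
    rw [← mul_sub] at h5
    exact le_of_mul_le_mul_left h5 hh
  linarith

end Abstract

/-! ### Mollification in `L²` -/

section Mollification

variable {d : ℕ} {X : Type*} [NormedAddCommGroup X] [NormedSpace ℝ X]

/-- A bump function supported in the ball of radius `1 / (n + 1)`. -/
def mollifierBump (d n : ℕ) : ContDiffBump (0 : EuclideanSpace ℝ (Fin d)) :=
  ⟨1 / (n + 1 : ℝ) / 2, 1 / (n + 1 : ℝ), by positivity, half_lt_self (by positivity)⟩

/-- The standard mollifier. -/
def mollifier (d n : ℕ) : EuclideanSpace ℝ (Fin d) → ℝ := (mollifierBump d n).normed volume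

/-- The mollification of `f`. -/
def mollify (n : ℕ) (f : EuclideanSpace ℝ (Fin d) → X) : EuclideanSpace ℝ (Fin d) → X :=
  mollifier d n ⋆[lsmul ℝ ℝ, volume] f

lemma contDiff_mollifier (n : ℕ) : ContDiff ℝ ∞ (mollifier d n) := (mollifierBump d n).contDiff_normed

lemma hasCompactSupport_mollifier (n : ℕ) : HasCompactSupport (mollifier d n) :=
  (mollifierBump d n).hasCompactSupport_normed

lemma mollifier_nonneg (n : ℕ) (x : EuclideanSpace ℝ (Fin d)) : 0 ≤ mollifier d n x :=
  (mollifierBump d n).nonneg_normed x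

lemma support_mollifier (n : ℕ) :
    Function.support (mollifier d n) = Metric.ball 0 (1 / (n + 1 : ℝ)) :=
  (mollifierBump d n).support_normed_eq

lemma mollify_apply (n : ℕ) (f : EuclideanSpace ℝ (Fin d) → X) (x : EuclideanSpace ℝ (Fin d)) :
    mollify n f x = ∫ t, mollifier d n t • f (x - t) := rfl

lemma mollify_apply_swap (n : ℕ) (f : EuclideanSpace ℝ (Fin d) → X)
    (x : EuclideanSpace ℝ (Fin d)) : mollify n f x = ∫ t, mollifier d n (x - t) • f t :=
  convolution_lsmul_swap

lemma lintegral_mollifier (n : ℕ) : ∫⁻ t, ENNReal.ofReal (mollifier d n t) = 1 := by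
  have h := ofReal_integral_eq_lintegral_ofReal (μ := volume)
    (mollifierBump d n).integrable_normed (.of_forall (mollifierBump d n).nonneg_normed)
  rw [(mollifierBump d n).integral_normed, ENNReal.ofReal_one] at h
  exact h.symm

lemma mollify_sub {f g : EuclideanSpace ℝ (Fin d) → X} (n : ℕ) (hf : LocallyIntegrable f volume)
    (hg : LocallyIntegrable g volume) : mollify n (f - g) = mollify n f - mollify n g := by
  have h : ∀ {k : EuclideanSpace ℝ (Fin d) → X}, LocallyIntegrable k volume →
      ConvolutionExists (mollifier d n) k (lsmul ℝ ℝ) volume := fun hk =>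
    (hasCompactSupport_mollifier n).convolutionExists_left _ (contDiff_mollifier n).continuous hk
  ext x
  simp only [mollify_apply, Pi.sub_apply, smul_sub]
  exact integral_sub (h hf x) (h hg x)

/-- The mollifier is a probability density, so the monotonicity of `Lᵖ` norms in `p` bounds the
square of the average by the average of the squares. Tonelli and translation invariance finish. -/
lemma eLpNorm_mollify_le (n : ℕ) {f : EuclideanSpace ℝ (Fin d) → X}
    (hf : AEStronglyMeasurable f volume) :
    eLpNorm (mollify n f) 2 volume ≤ eLpNorm f 2 volume := by
  set r : EuclideanSpace ℝ (Fin d) → ℝ≥0∞ := fun t => ENNReal.ofReal (mollifier d n t) with hr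
  have hrm : Measurable r := (contDiff_mollifier n).continuous.measurable.ennreal_ofReal
  have sq : ∀ {ν : Measure (EuclideanSpace ℝ (Fin d))} {h : EuclideanSpace ℝ (Fin d) → X},
      eLpNorm h 2 ν ^ (2 : ℝ) = ∫⁻ x, ‖h x‖ₑ ^ (2 : ℝ) ∂ν := by
    intro ν h
    simpa using eLpNorm_nnreal_pow_eq_lintegral (μ := ν) (f := h) (p := 2) (by norm_num)
  have hprob : IsProbabilityMeasure (volume.withDensity r) :=
    ⟨by rw [withDensity_apply _ MeasurableSet.univ, Measure.restrict_univ]; exact lintegral_mollifier n⟩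
  have hshift : ∀ x, AEStronglyMeasurable (fun t => f (x - t)) volume := fun x =>
    hf.comp_quasiMeasurePreserving (Measure.measurePreserving_sub_left volume x).quasiMeasurePreserving
  have hpt : ∀ x, ‖mollify n f x‖ₑ ^ (2 : ℝ) ≤ ∫⁻ t, r t * ‖f (x - t)‖ₑ ^ (2 : ℝ) := by
    intro x
    have h1 : ‖mollify n f x‖ₑ ≤ ∫⁻ t, r t * ‖f (x - t)‖ₑ := by
      rw [mollify_apply]
      refine (enorm_integral_le_lintegral_enorm _).trans (le_of_eq ?_)
      refine lintegral_congr fun t => ?_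
      rw [enorm_smul, Real.enorm_of_nonneg (mollifier_nonneg n t)]
    have h2 : ∫⁻ t, r t * ‖f (x - t)‖ₑ
        = eLpNorm (fun t => f (x - t)) 1 (volume.withDensity r) := by
      rw [eLpNorm_one_eq_lintegral_enorm, lintegral_withDensity_eq_lintegral_mul₀ hrm.aemeasurable
        (hshift x).enorm]
      rfl
    have h3 : eLpNorm (fun t => f (x - t)) 1 (volume.withDensity r)
        ≤ eLpNorm (fun t => f (x - t)) 2 (volume.withDensity r) :=
      eLpNorm_le_eLpNorm_of_exponent_le (by norm_num)
        ((hshift x).mono_ac (withDensity_absolutelyContinuous _ _))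
    calc ‖mollify n f x‖ₑ ^ (2 : ℝ)
        ≤ eLpNorm (fun t => f (x - t)) 2 (volume.withDensity r) ^ (2 : ℝ) := by
          gcongr
          exact h1.trans (h2.le.trans h3)
      _ = ∫⁻ t, r t * ‖f (x - t)‖ₑ ^ (2 : ℝ) := by
          rw [sq, lintegral_withDensity_eq_lintegral_mul₀ hrm.aemeasurable
            ((hshift x).enorm.pow_const _)]
          rfl
  have hmeas : AEMeasurable (Function.uncurry fun x t : EuclideanSpace ℝ (Fin d) =>
      r t * ‖f (x - t)‖ₑ ^ (2 : ℝ)) (volume.prod volume) := by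
    refine (hrm.comp measurable_snd).aemeasurable.mul (AEMeasurable.pow_const ?_ _)
    exact (hf.comp_quasiMeasurePreserving
      (quasiMeasurePreserving_sub_of_right_invariant volume volume)).enorm
  rw [← ENNReal.rpow_le_rpow_iff (z := 2) (by norm_num), sq, sq]
  calc ∫⁻ x, ‖mollify n f x‖ₑ ^ (2 : ℝ)
      ≤ ∫⁻ x, ∫⁻ t, r t * ‖f (x - t)‖ₑ ^ (2 : ℝ) := lintegral_mono hpt
    _ = ∫⁻ t, ∫⁻ x, r t * ‖f (x - t)‖ₑ ^ (2 : ℝ) := lintegral_lintegral_swap hmeas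
    _ = ∫⁻ t, r t * ∫⁻ x, ‖f x‖ₑ ^ (2 : ℝ) := by
        refine lintegral_congr fun t => ?_
        rw [lintegral_const_mul' _ _ ENNReal.ofReal_ne_top,
          lintegral_sub_right_eq_self (fun x => ‖f x‖ₑ ^ (2 : ℝ)) t]
    _ = ∫⁻ x, ‖f x‖ₑ ^ (2 : ℝ) := by
        rw [lintegral_mul_const _ hrm, lintegral_mollifier, one_mul]

lemma contDiff_mollify [CompleteSpace X] (n : ℕ) {f : EuclideanSpace ℝ (Fin d) → X}
    (hf : LocallyIntegrable f volume) : ContDiff ℝ ∞ (mollify n f) :=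
  (hasCompactSupport_mollifier n).contDiff_convolution_left _ (contDiff_mollifier n) hf

/-- `mollify n f x` only depends on the values of `f` on the ball of radius `1 / (n + 1)`. -/
lemma mollify_eq_zero {n : ℕ} {f : EuclideanSpace ℝ (Fin d) → X} {x : EuclideanSpace ℝ (Fin d)}
    (h : ∀ᵐ t, t ∈ Metric.ball x (1 / (n + 1 : ℝ)) → f t = 0) : mollify n f x = 0 := by
  rw [mollify_apply_swap]
  refine integral_eq_zero_of_ae ?_
  filter_upwards [h] with t ht
  by_cases hx : t ∈ Metric.ball x (1 / (n + 1 : ℝ))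
  · simp [ht hx]
  · have : mollifier d n (x - t) = 0 := by
      rw [← Function.notMem_support, support_mollifier, mem_ball_zero_iff, ← dist_eq_norm, dist_comm]
      exact hx
    simp [this]

lemma tendsto_one_div_nat_succ : Filter.Tendsto (fun n : ℕ => 1 / (n + 1 : ℝ)) Filter.atTop (nhds 0) :=
  tendsto_one_div_add_atTop_nhds_zero_nat

/-- Uniform continuity gives uniform convergence, and all supports lie in the 1-thickening of the
support of `c`, a set of finite measure. -/
lemma tendsto_eLpNorm_mollify_sub_of_continuous [CompleteSpace X]
    {c : EuclideanSpace ℝ (Fin d) → X} (hc : Continuous c) (hcs : HasCompactSupport c) :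
    Filter.Tendsto (fun n => eLpNorm (mollify n c - c) 2 volume) Filter.atTop (nhds 0) := by
  set S := Metric.cthickening 1 (tsupport c) with hS
  have hSc : IsCompact S := IsCompact.cthickening hcs
  have hSf : volume S ^ (1 / (2 : ℝ≥0∞).toReal) ≠ ⊤ :=
    ENNReal.rpow_ne_top_of_nonneg (by norm_num) hSc.measure_lt_top.ne
  have hu : UniformContinuous c := hc.uniformContinuous_of_tendsto_cocompact hcs.is_zero_at_infty
  rw [ENNReal.tendsto_nhds_zero]
  intro ε hε
  rcases eq_or_ne ε ⊤ with rfl | hε'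
  · simp
  obtain ⟨δ, hδ, hδε⟩ : ∃ δ : ℝ, 0 < δ ∧
      ENNReal.ofReal δ * volume S ^ (1 / (2 : ℝ≥0∞).toReal) ≤ ε := by
    have hlim : Filter.Tendsto
        (fun δ : ℝ => ENNReal.ofReal δ * volume S ^ (1 / (2 : ℝ≥0∞).toReal))
        (nhdsWithin 0 (Ioi 0)) (nhds 0) := by
      have h1 : Filter.Tendsto (fun δ : ℝ => ENNReal.ofReal δ) (nhdsWithin 0 (Ioi 0)) (nhds 0) := by
        simpa using (ENNReal.continuous_ofReal.tendsto 0).mono_left nhdsWithin_le_nhds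
      simpa using ENNReal.Tendsto.mul_const h1 (Or.inr hSf)
    obtain ⟨δ, h1, h2⟩ := ((hlim.eventually_le_const hε).and self_mem_nhdsWithin).exists
    exact ⟨δ, h2, h1⟩
  obtain ⟨r, hr, hcr⟩ := Metric.uniformContinuous_iff.1 hu δ hδ
  filter_upwards [tendsto_one_div_nat_succ.eventually (gt_mem_nhds hr)] with n hn
  refine (eLpNorm_sub_le_of_dist_bdd volume (by norm_num) hSc.isClosed.measurableSet hδ.le
    (fun x => ?_) (fun x hx => ?_) ?_).trans hδε
  · refine (mollifierBump d n).dist_normed_convolution_le hc.aestronglyMeasurable fun y hy => ?_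
    exact (hcr (lt_trans hy hn)).le
  · by_contra h
    refine hx (mollify_eq_zero (.of_forall fun t ht => ?_))
    refine image_eq_zero_of_notMem_tsupport fun h' => h ?_
    refine Metric.mem_cthickening_of_dist_le x t 1 _ h' ?_
    rw [dist_comm]
    refine (le_of_lt ht).trans ?_
    rw [div_le_one (by positivity)]
    have : (0 : ℝ) ≤ n := n.cast_nonneg
    linarith
  · exact (subset_tsupport c).trans (Metric.self_subset_cthickening _)

/-- Mollifications of a square integrable function converge in `L²`. -/
theorem tendsto_eLpNorm_mollify_sub [CompleteSpace X] {f : EuclideanSpace ℝ (Fin d) → X}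
    (hf : MemLp f 2 volume) :
    Filter.Tendsto (fun n => eLpNorm (mollify n f - f) 2 volume) Filter.atTop (nhds 0) := by
  rw [ENNReal.tendsto_nhds_zero]
  intro ε hε
  have hε3 : ε / 3 ≠ 0 := (ENNReal.div_pos hε.ne' (by norm_num)).ne'
  obtain ⟨c, h1, h2, h3, h4⟩ := hf.exists_hasCompactSupport_eLpNorm_sub_le (by norm_num) hε3
  filter_upwards [(ENNReal.tendsto_nhds_zero.1 (tendsto_eLpNorm_mollify_sub_of_continuous h3 h1))
    (ε / 3) (pos_iff_ne_zero.2 hε3)] with n hn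
  have hfl := hf.locallyIntegrable (by norm_num)
  have hcl := h4.locallyIntegrable (by norm_num)
  have e : mollify n f - f = mollify n (f - c) + (mollify n c - c) - (f - c) := by
    rw [mollify_sub n hfl hcl]
    abel
  have m1 : AEStronglyMeasurable (mollify n (f - c)) volume :=
    (contDiff_mollify n (hfl.sub hcl)).continuous.aestronglyMeasurable
  have m2 : AEStronglyMeasurable (mollify n c - c) volume :=
    (contDiff_mollify n hcl).continuous.aestronglyMeasurable.sub h4.1
  have m3 : AEStronglyMeasurable (f - c) volume := hf.1.sub h4.1
  rw [e]
  calc _ ≤ eLpNorm (mollify n (f - c)) 2 volume + eLpNorm (mollify n c - c) 2 volume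
        + eLpNorm (f - c) 2 volume :=
        (eLpNorm_sub_le (m1.add m2) m3 (by norm_num)).trans
          (add_le_add_left (eLpNorm_add_le m1 m2 (by norm_num)) _)
    _ ≤ ε / 3 + ε / 3 + ε / 3 := by
        gcongr
        exact (eLpNorm_mollify_le n m3).trans h2
    _ = ε := ENNReal.add_thirds ε

lemma memLp_mollify [CompleteSpace X] (n : ℕ) {f : EuclideanSpace ℝ (Fin d) → X}
    (hf : MemLp f 2 volume) : MemLp (mollify n f) 2 volume :=
  ⟨(contDiff_mollify n (hf.locallyIntegrable (by norm_num))).continuous.aestronglyMeasurable,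
    (eLpNorm_mollify_le n hf.1).trans_lt hf.2⟩

end Mollification

/-! ### Basic properties of `H¹(Ω)` -/

section H1

variable {d : ℕ} {Ω : TopologicalSpace.Opens (EuclideanSpace ℝ (Fin d))}

/-- A smooth compactly supported function with support in `Ω`, as a bundled test function. -/
def mkTest (φ : EuclideanSpace ℝ (Fin d) → ℝ) (h₁ : ContDiff ℝ ∞ φ) (h₂ : HasCompactSupport φ)
    (h₃ : tsupport φ ⊆ Ω) : 𝓓(Ω, ℝ) :=
  ⟨φ, by simpa using h₁, h₂, h₃⟩

@[simp] lemma coe_mkTest (φ : EuclideanSpace ℝ (Fin d) → ℝ) (h₁ : ContDiff ℝ ∞ φ)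
    (h₂ : HasCompactSupport φ) (h₃ : tsupport φ ⊆ Ω) : ⇑(mkTest φ h₁ h₂ h₃) = φ := rfl

/-- The restriction of Lebesgue measure to `Ω`. -/
abbrev spaceMeasure (Ω : TopologicalSpace.Opens (EuclideanSpace ℝ (Fin d))) :
    Measure (EuclideanSpace ℝ (Fin d)) := volume.restrict (Ω : Set (EuclideanSpace ℝ (Fin d)))

/-- A function in `L²(Ω)` with weak gradient in `L²(Ω; ℝᵈ)` as an element of `H¹(Ω)`. -/
def H1.mk (u : L2 Ω) (G : L2Field Ω) (h : IsWeakGradient Ω u G) : H1 Ω :=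
  (⟨WithLp.toLp 2 (u, G), h⟩ : gradientGraph Ω)

@[simp] lemma H1.toL2_mk (u : L2 Ω) (G : L2Field Ω) (h : IsWeakGradient Ω u G) :
    H1.toL2 Ω (H1.mk u G h) = u := rfl

@[simp] lemma H1.grad_mk (u : L2 Ω) (G : L2Field Ω) (h : IsWeakGradient Ω u G) :
    H1.grad Ω (H1.mk u G h) = G := rfl

lemma H1.isWeakGradient (u : H1 Ω) : IsWeakGradient Ω (H1.toL2 Ω u) (H1.grad Ω u) :=
  Subtype.property (p := fun p => p ∈ gradientGraph Ω) u

lemma H1.norm_sq (u : H1 Ω) : ‖u‖ ^ 2 = ‖H1.toL2 Ω u‖ ^ 2 + ‖H1.grad Ω u‖ ^ 2 :=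
  WithLp.prod_norm_sq_eq_of_L2 (Subtype.val (p := fun p => p ∈ gradientGraph Ω) u)

lemma H1.norm_le_of_le {u v : H1 Ω} (h₁ : ‖H1.toL2 Ω u‖ ≤ ‖H1.toL2 Ω v‖)
    (h₂ : ‖H1.grad Ω u‖ ≤ ‖H1.grad Ω v‖) : ‖u‖ ≤ ‖v‖ := by
  refine le_of_sq_le_sq ?_ (norm_nonneg _)
  rw [H1.norm_sq, H1.norm_sq]
  gcongr

lemma integral_coord_eq (G : L2Field Ω) (φ : EuclideanSpace ℝ (Fin d) → ℝ)
    (hφ : MemLp φ 2 (spaceMeasure Ω)) (k : Fin d) :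
    ∫ x in Ω, G x k * φ x
      = ⟪(hφ.continuousLinearMap_comp
          (ContinuousLinearMap.toSpanSingleton ℝ (EuclideanSpace.single k (1 : ℝ)))).toLp, G⟫_ℝ := by
  rw [L2.inner_def]
  refine integral_congr_ae ?_
  filter_upwards [(hφ.continuousLinearMap_comp
    (ContinuousLinearMap.toSpanSingleton ℝ (EuclideanSpace.single k (1 : ℝ)))).coeFn_toLp] with x hx
  rw [hx]
  simp [inner_smul_left, EuclideanSpace.inner_single_left, mul_comm]

lemma integral_mul_eq_inner (u : L2 Ω) (φ : EuclideanSpace ℝ (Fin d) → ℝ)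
    (hφ : MemLp φ 2 (spaceMeasure Ω)) : ∫ x in Ω, u x * φ x = ⟪hφ.toLp, u⟫_ℝ := by
  rw [L2.inner_def]
  refine integral_congr_ae ?_
  filter_upwards [hφ.coeFn_toLp] with x hx
  rw [hx]
  simp

/-- Each defining condition equates inner products with fixed `L²` elements, hence is closed. This
makes `H¹(Ω)` a Hilbert space. -/
lemma isClosed_gradientGraph :
    IsClosed (gradientGraph Ω : Set (WithLp 2 (L2 Ω × L2Field Ω))) := by
  have : (gradientGraph Ω : Set (WithLp 2 (L2 Ω × L2Field Ω))) =
      ⋂ (φ : 𝓓(Ω, ℝ)) (k : Fin d), {p | ⟪(memLp_partialDeriv φ k).toLp, p.fst⟫_ℝ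
        = -⟪((memLp_testFunction φ).continuousLinearMap_comp (ContinuousLinearMap.toSpanSingleton ℝ
          (EuclideanSpace.single k (1 : ℝ)))).toLp, p.snd⟫_ℝ} := by
    ext p
    simp only [mem_iInter]
    refine forall_congr' fun φ => forall_congr' fun k => ?_
    rw [mem_ofPred_eq, ← integral_mul_eq_inner, ← integral_coord_eq p.snd φ (memLp_testFunction φ)]
  rw [this]
  refine isClosed_iInter fun φ => isClosed_iInter fun k => isClosed_eq ?_ ?_
  · exact continuous_const.inner (WithLp.fstL 2 ℝ (L2 Ω) (L2Field Ω)).continuous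
  · exact (continuous_const.inner (WithLp.sndL 2 ℝ (L2 Ω) (L2Field Ω)).continuous).neg

instance : CompleteSpace (H1 Ω) :=
  (isClosed_gradientGraph (Ω := Ω)).completeSpace_coe

/-- Separability is what lets `ae_forall_nonneg` choose one null set of times for all test
functions. -/
instance : SecondCountableTopology (H1 Ω) := by
  have : Fact ((2 : ℝ≥0∞) ≠ ⊤) := ⟨by norm_num⟩
  have h₁ : SecondCountableTopology (L2 Ω) := Lp.SecondCountableTopology
  have h₂ : SecondCountableTopology (L2Field Ω) := Lp.SecondCountableTopology
  have : SecondCountableTopology (WithLp 2 (L2 Ω × L2Field Ω)) :=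
    (WithLp.homeomorphProd 2 (L2 Ω) (L2Field Ω)).secondCountableTopology
  exact inferInstanceAs (SecondCountableTopology (gradientGraph Ω))

/-- The weak gradient vanishes on open sets where the function vanishes. -/
lemma H1.grad_ae_eq_zero {U : Set (EuclideanSpace ℝ (Fin d))} (hU : IsOpen U) (hUΩ : U ⊆ Ω)
    {u : H1 Ω} (hu : ∀ᵐ x ∂(spaceMeasure Ω), x ∈ U → H1.toL2 Ω u x = 0) :
    ∀ᵐ x ∂(spaceMeasure Ω), x ∈ U → H1.grad Ω u x = 0 := by
  have key : ∀ k : Fin d, ∀ᵐ x, x ∈ U → H1.grad Ω u x k = 0 := by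
    intro k
    have hloc : LocallyIntegrableOn (fun x => H1.grad Ω u x k) U volume := by
      refine LocallyIntegrableOn.mono_set ?_ hUΩ
      refine locallyIntegrableOn_of_locallyIntegrable_restrict ?_
      exact (memLp_coord (H1.grad Ω u) k).locallyIntegrable (by norm_num)
    refine hU.ae_eq_zero_of_integral_contDiff_smul_eq_zero hloc fun φ h1 h2 h3 => ?_
    have := H1.isWeakGradient u (mkTest φ h1 h2 (h3.trans hUΩ)) k
    rw [integral_eq_zero_of_ae, eq_comm, neg_eq_zero] at this
    · rw [← this, coe_mkTest]
      simp only [smul_eq_mul, mul_comm]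
      refine (setIntegral_eq_integral_of_forall_compl_eq_zero fun x hx => ?_).symm
      rw [image_eq_zero_of_notMem_tsupport fun h => hx (hUΩ (h3 h)), zero_mul]
    · filter_upwards [hu] with x hx
      by_cases hxU : x ∈ U
      · simp [hx hxU]
      · have : ParabolicForms.partialDeriv k φ x = 0 := by
          rw [ParabolicForms.partialDeriv, fderiv_of_notMem_tsupport ℝ fun h => hxU (h3 h)]
          rfl
        simp [this]
  have h2 := ae_restrict_of_ae (s := (Ω : Set (EuclideanSpace ℝ (Fin d)))) (ae_all_iff.2 key)
  filter_upwards [h2] with x hx hxU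
  ext k
  simpa using hx k hxU

/-- The weak gradient is determined by the function. Injectivity gives the adjoint of the embedding
a dense range, as needed in `mem_of_bounded_of_tendsto_comp`. -/
lemma H1.toL2_injective : Function.Injective (H1.toL2 Ω) := by
  rw [injective_iff_map_eq_zero]
  intro u hu
  have h1 : ∀ᵐ x ∂(spaceMeasure Ω), x ∈ (Ω : Set _) → H1.toL2 Ω u x = 0 := by
    rw [hu]
    filter_upwards [Lp.coeFn_zero ℝ 2 (spaceMeasure Ω)] with x hx _
    rw [hx]; rfl
  have h2 := H1.grad_ae_eq_zero Ω.isOpen Subset.rfl h1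
  have h3 : H1.grad Ω u = 0 := by
    rw [Lp.eq_zero_iff_ae_eq_zero]
    filter_upwards [h2, ae_restrict_mem Ω.isOpen.measurableSet] with x hx hxΩ using hx hxΩ
  have := H1.norm_sq u
  rw [hu, h3] at this
  simpa using this

/-! ### Extension by zero and mollification -/

/-- The extension by zero of a function on `Ω`. -/
abbrev extendZero {X : Type*} [Zero X] (Ω : TopologicalSpace.Opens (EuclideanSpace ℝ (Fin d)))
    (u : EuclideanSpace ℝ (Fin d) → X) : EuclideanSpace ℝ (Fin d) → X :=
  (Ω : Set (EuclideanSpace ℝ (Fin d))).indicator u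

lemma memLp_extendZero {X : Type*} [NormedAddCommGroup X] {u : EuclideanSpace ℝ (Fin d) → X}
    (hu : MemLp u 2 (spaceMeasure Ω)) : MemLp (extendZero Ω u) 2 volume :=
  (memLp_indicator_iff_restrict Ω.isOpen.measurableSet).2 hu

lemma integral_extendZero_mul (u φ : EuclideanSpace ℝ (Fin d) → ℝ) :
    ∫ x, extendZero Ω u x * φ x = ∫ x in Ω, u x * φ x := by
  rw [← integral_indicator Ω.isOpen.measurableSet]
  refine integral_congr_ae (.of_forall fun x => ?_)
  simp only [indicator]
  split_ifs <;> simp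

/-- Inside `Ω`, mollification commutes with weak differentiation. -/
lemma partialDeriv_mollify {u : H1 Ω} {n : ℕ} {x : EuclideanSpace ℝ (Fin d)}
    (hx : Metric.closedBall x (1 / (n + 1 : ℝ)) ⊆ Ω) (k : Fin d) :
    partialDeriv k (mollify n (extendZero Ω (H1.toL2 Ω u))) x
      = mollify n (extendZero Ω (H1.grad Ω u)) x k := by
  have hu := (memLp_extendZero (Lp.memLp (H1.toL2 Ω u))).locallyIntegrable (by norm_num)
  have hG := (memLp_extendZero (Lp.memLp (H1.grad Ω u))).locallyIntegrable (by norm_num)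
  have hρ : ContDiff ℝ 1 (mollifier d n) := (contDiff_mollifier n).of_le (by simp)
  have hex := (hasCompactSupport_mollifier (d := d) n).fderiv (𝕜 := ℝ) |>.convolutionExists_left
    ((lsmul ℝ ℝ : ℝ →L[ℝ] ℝ →L[ℝ] ℝ).precompL (EuclideanSpace ℝ (Fin d)))
    (hρ.continuous_fderiv one_ne_zero) hu x
  have h1 : partialDeriv k (mollify n (extendZero Ω (H1.toL2 Ω u))) x
      = ∫ t, fderiv ℝ (mollifier d n) t (EuclideanSpace.single k 1)
          * extendZero Ω (H1.toL2 Ω u) (x - t) := by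
    rw [partialDeriv, mollify, ((hasCompactSupport_mollifier n).hasFDerivAt_convolution_left _ hρ hu
      x).fderiv, convolution_def, ContinuousLinearMap.integral_apply hex]
    rfl
  have h2 : ∫ t, fderiv ℝ (mollifier d n) t (EuclideanSpace.single k 1)
          * extendZero Ω (H1.toL2 Ω u) (x - t)
      = ∫ t, fderiv ℝ (mollifier d n) (x - t) (EuclideanSpace.single k 1)
          * extendZero Ω (H1.toL2 Ω u) t := by
    rw [← integral_sub_left_eq_self _ volume x]
    simp
  -- The reflected mollifier centred at `x` is a test function on `Ω`, because the closed ball lies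
  -- in `Ω`. The sign from the reflection cancels the sign in the definition of the weak gradient.
  set φ : EuclideanSpace ℝ (Fin d) → ℝ := fun t => mollifier d n (x - t) with hφ
  have hφd : ∀ t, partialDeriv k φ t
      = -fderiv ℝ (mollifier d n) (x - t) (EuclideanSpace.single k 1) := by
    intro t
    have hd : HasFDerivAt φ ((fderiv ℝ (mollifier d n) (x - t)).comp
        (-ContinuousLinearMap.id ℝ (EuclideanSpace ℝ (Fin d)))) t :=
      ((hρ.differentiable one_ne_zero (x - t)).hasFDerivAt).comp t ((hasFDerivAt_id t).const_sub x)
    rw [partialDeriv, hd.fderiv]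
    simp
  have hφs : tsupport φ ⊆ Metric.closedBall x (1 / (n + 1 : ℝ)) := by
    refine closure_minimal (fun t ht => ?_) Metric.isClosed_closedBall
    have : x - t ∈ Function.support (mollifier d n) := ht
    rw [support_mollifier, mem_ball_zero_iff, ← dist_eq_norm, dist_comm] at this
    exact this.le
  have hw := H1.isWeakGradient u (mkTest φ ((contDiff_mollifier n).comp
    (contDiff_const.sub contDiff_id)) (HasCompactSupport.of_support_subset_isCompact
      (isCompact_closedBall x _) ((subset_tsupport _).trans hφs)) (hφs.trans hx)) k
  rw [coe_mkTest, ← integral_extendZero_mul, ← integral_extendZero_mul] at hw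
  have hexG : Integrable fun t => mollifier d n (x - t) • extendZero Ω (H1.grad Ω u) t := by
    have := (hasCompactSupport_mollifier (d := d) n).convolutionExists_left
      (lsmul ℝ ℝ : ℝ →L[ℝ] EuclideanSpace ℝ (Fin d) →L[ℝ] EuclideanSpace ℝ (Fin d))
      (contDiff_mollifier n).continuous hG x
    exact this.integrable_swap
  have h3 : mollify n (extendZero Ω (H1.grad Ω u)) x k
      = ∫ t, extendZero Ω (fun x => H1.grad Ω u x k) t * φ t := by
    rw [mollify_apply_swap]
    change EuclideanSpace.proj (𝕜 := ℝ) k (∫ t, mollifier d n (x - t) • extendZero Ω (H1.grad Ω u) t)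
      = _
    rw [← ContinuousLinearMap.integral_comp_comm _ hexG]
    refine integral_congr_ae (.of_forall fun t => ?_)
    simp only [map_smul, smul_eq_mul, hφ, mul_comm, indicator]
    split_ifs <;> simp
  rw [h1, h2, h3, ← neg_neg (∫ t, extendZero Ω (fun x => H1.grad Ω u x k) t * φ t), ← hw,
    ← integral_neg]
  refine integral_congr_ae (.of_forall fun t => ?_)
  simp only [hφd]
  ring

end H1

/-! ### The lattice structure of `H¹(Ω)` -/

lemma tendsto_integral_mul_of_eLpNorm {α : Type*} [MeasurableSpace α] {μ : Measure α}
    {a b : ℕ → α → ℝ} {a₀ b₀ : α → ℝ} (ha : ∀ n, MemLp (a n) 2 μ) (ha₀ : MemLp a₀ 2 μ)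
    (hb : ∀ n, MemLp (b n) 2 μ) (hb₀ : MemLp b₀ 2 μ)
    (hta : Filter.Tendsto (fun n => eLpNorm (a n - a₀) 2 μ) Filter.atTop (nhds 0))
    (htb : Filter.Tendsto (fun n => eLpNorm (b n - b₀) 2 μ) Filter.atTop (nhds 0)) :
    Filter.Tendsto (fun n => ∫ x, a n x * b n x ∂μ) Filter.atTop (nhds (∫ x, a₀ x * b₀ x ∂μ)) := by
  have hi : ∀ {f g : α → ℝ} (hf : MemLp f 2 μ) (hg : MemLp g 2 μ),
      ∫ x, f x * g x ∂μ = ⟪hg.toLp, hf.toLp⟫_ℝ := by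
    intro f g hf hg
    rw [L2.inner_def]
    refine integral_congr_ae ?_
    filter_upwards [hf.coeFn_toLp, hg.coeFn_toLp] with x h1 h2
    simp [h1, h2]
  have hA := (Lp.tendsto_Lp_iff_tendsto_eLpNorm'' a ha a₀ ha₀).2 hta
  have hB := (Lp.tendsto_Lp_iff_tendsto_eLpNorm'' b hb b₀ hb₀).2 htb
  rw [hi ha₀ hb₀]
  exact (hB.inner hA).congr fun n => (hi (ha n) (hb n)).symm

/-- A smooth approximation of the absolute value. -/
def smoothAbs (ε x : ℝ) : ℝ := √(x ^ 2 + ε ^ 2) - ε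

/-! ### Estimates for the regularised absolute value -/

section smoothAbs

variable {ε : ℝ}

lemma sqrt_sq_add_pos (hε : 0 < ε) (x : ℝ) : 0 < √(x ^ 2 + ε ^ 2) := by positivity

lemma hasDerivAt_smoothAbs (hε : 0 < ε) (x : ℝ) :
    HasDerivAt (smoothAbs ε) (x / √(x ^ 2 + ε ^ 2)) x := by
  have h : HasDerivAt (fun y : ℝ => y ^ 2 + ε ^ 2) (2 * x) x := by
    simpa using (hasDerivAt_pow 2 x).add_const (ε ^ 2)
  have h' := (h.sqrt (by positivity)).sub_const ε
  convert! h' using 1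
  field_simp

lemma abs_le_sqrt_sq_add (x : ℝ) : |x| ≤ √(x ^ 2 + ε ^ 2) :=
  Real.abs_le_sqrt (by nlinarith [sq_nonneg ε])

lemma abs_div_sqrt_le (x : ℝ) : |x / √(x ^ 2 + ε ^ 2)| ≤ 1 := by
  rw [abs_div, abs_of_nonneg (Real.sqrt_nonneg _)]
  exact div_le_one_of_le₀ (abs_le_sqrt_sq_add x) (Real.sqrt_nonneg _)

lemma abs_smoothAbs_sub_le (hε : 0 < ε) (x y : ℝ) :
    |smoothAbs ε x - smoothAbs ε y| ≤ |x - y| := by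
  have := Convex.norm_image_sub_le_of_norm_hasDerivWithin_le (f := smoothAbs ε) (s := univ)
    (C := 1) (fun x _ => (hasDerivAt_smoothAbs hε x).hasDerivWithinAt)
    (fun x _ => abs_div_sqrt_le x) convex_univ (mem_univ y) (mem_univ x)
  simpa using this

/-- The shift by `-ε` makes the regularisation vanish at zero, so composition preserves `L²` and
commutes with extension by zero. -/
lemma abs_smoothAbs_le (hε : 0 < ε) (x : ℝ) : |smoothAbs ε x| ≤ |x| := by
  have := abs_smoothAbs_sub_le hε x 0
  simpa [smoothAbs, Real.sqrt_sq hε.le] using this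

/-- The derivative is `ε ^ 2 / √(x ^ 2 + ε ^ 2) ^ 3`, and the root is at least `ε`. The constant
blows up as `ε → 0`, which is harmless: `ε` stays fixed while the mollification parameter tends to
its limit. -/
lemma abs_div_sqrt_sub_le (hε : 0 < ε) (x y : ℝ) :
    |x / √(x ^ 2 + ε ^ 2) - y / √(y ^ 2 + ε ^ 2)| ≤ 1 / ε * |x - y| := by
  have hd : ∀ x : ℝ, HasDerivAt (fun x : ℝ => x / √(x ^ 2 + ε ^ 2))
      (ε ^ 2 / √(x ^ 2 + ε ^ 2) ^ 3) x := by
    intro x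
    have h : HasDerivAt (fun y : ℝ => √(y ^ 2 + ε ^ 2)) (x / √(x ^ 2 + ε ^ 2)) x := by
      simpa [smoothAbs] using (hasDerivAt_smoothAbs hε x).add_const ε
    convert! (hasDerivAt_id x).div h (sqrt_sq_add_pos hε x).ne' using 1
    have h1 := sqrt_sq_add_pos hε x
    have h2 : √(x ^ 2 + ε ^ 2) ^ 2 = x ^ 2 + ε ^ 2 := Real.sq_sqrt (by positivity)
    field_simp
    simp only [id]
    linarith
  have hb : ∀ x : ℝ, ‖ε ^ 2 / √(x ^ 2 + ε ^ 2) ^ 3‖ ≤ 1 / ε := by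
    intro x
    have h1 : ε ≤ √(x ^ 2 + ε ^ 2) := Real.le_sqrt_of_sq_le (by nlinarith [sq_nonneg x])
    rw [Real.norm_of_nonneg (by positivity), div_le_div_iff₀ (by positivity) hε]
    calc ε ^ 2 * ε = ε ^ 3 := by ring
      _ ≤ √(x ^ 2 + ε ^ 2) ^ 3 := by gcongr
      _ = 1 * √(x ^ 2 + ε ^ 2) ^ 3 := by ring
  have := Convex.norm_image_sub_le_of_norm_hasDerivWithin_le
    (f := fun x : ℝ => x / √(x ^ 2 + ε ^ 2)) (s := univ)
    (C := 1 / ε) (fun x _ => (hd x).hasDerivWithinAt)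
    (fun x _ => hb x) convex_univ (mem_univ y) (mem_univ x)
  simpa using this

lemma continuous_div_sqrt (hε : 0 < ε) : Continuous fun x : ℝ => x / √(x ^ 2 + ε ^ 2) := by
  refine continuous_id.div (by fun_prop) fun x => (sqrt_sq_add_pos hε x).ne'

lemma continuous_smoothAbs (ε : ℝ) : Continuous (smoothAbs ε) := by
  unfold smoothAbs
  fun_prop

lemma tendsto_smoothAbs (x : ℝ) :
    Filter.Tendsto (fun n : ℕ => smoothAbs (1 / (n + 1 : ℝ)) x) Filter.atTop (nhds |x|) := by
  have hc : Continuous fun ε : ℝ => smoothAbs ε x := by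
    unfold smoothAbs
    fun_prop
  have := (hc.tendsto 0).comp tendsto_one_div_nat_succ
  simpa [smoothAbs, Real.sqrt_sq_eq_abs, Function.comp_def] using this

lemma tendsto_div_sqrt (x : ℝ) :
    Filter.Tendsto (fun n : ℕ => x / √(x ^ 2 + (1 / (n + 1 : ℝ)) ^ 2)) Filter.atTop
      (nhds (SignType.sign x : ℝ)) := by
  rcases eq_or_ne x 0 with rfl | hx
  · simp
  have hc : ContinuousAt (fun ε : ℝ => x / √(x ^ 2 + ε ^ 2)) 0 := by
    refine ContinuousAt.div (by fun_prop) (by fun_prop) ?_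
    simp [Real.sqrt_sq_eq_abs, hx]
  have := hc.tendsto.comp tendsto_one_div_nat_succ
  have e : x / √(x ^ 2 + 0 ^ 2) = (SignType.sign x : ℝ) := by
    rw [zero_pow two_ne_zero, add_zero, Real.sqrt_sq_eq_abs]
    rcases hx.lt_or_gt with h | h
    · rw [abs_of_neg h, sign_neg h, div_neg, div_self hx]; simp
    · rw [abs_of_pos h, sign_pos h, div_self hx]; simp
  rw [e] at this
  exact this

end smoothAbs

/-! ### Chain rule and lattice operations in `H¹(Ω)` -/

section H1

variable {d : ℕ} {Ω : TopologicalSpace.Opens (EuclideanSpace ℝ (Fin d))}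

lemma eventually_closedBall_subset {K : Set (EuclideanSpace ℝ (Fin d))} (hK : IsCompact K)
    (hKΩ : K ⊆ Ω) : ∃ N : ℕ, ∀ n ≥ N, ∀ x ∈ K, Metric.closedBall x (1 / (n + 1 : ℝ)) ⊆ Ω := by
  obtain ⟨δ, hδ, h⟩ := hK.exists_cthickening_subset_open Ω.isOpen hKΩ
  obtain ⟨N, hN⟩ := Filter.eventually_atTop.1 (tendsto_one_div_nat_succ.eventually (ge_mem_nhds hδ))
  refine ⟨N, fun n hn x hx y hy => h ?_⟩
  exact Metric.mem_cthickening_of_dist_le y x δ K hx (le_trans hy (hN n hn))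

lemma memLp_coord_of_memLp {G : EuclideanSpace ℝ (Fin d) → EuclideanSpace ℝ (Fin d)}
    {μ : Measure (EuclideanSpace ℝ (Fin d))} (hG : MemLp G 2 μ) (k : Fin d) :
    MemLp (fun x => G x k) 2 μ :=
  hG.continuousLinearMap_comp (EuclideanSpace.proj (𝕜 := ℝ) k)

/-- The chain rule for `smoothAbs ε`. -/
lemma integral_smoothAbs_mul_partialDeriv {ε : ℝ} (hε : 0 < ε) (u : H1 Ω) (φ : 𝓓(Ω, ℝ))
    (k : Fin d) :
    ∫ x in Ω, smoothAbs ε (H1.toL2 Ω u x) * partialDeriv k φ x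
      = -∫ x in Ω, H1.toL2 Ω u x / √(H1.toL2 Ω u x ^ 2 + ε ^ 2) * H1.grad Ω u x k * φ x := by
  set v := extendZero Ω (H1.toL2 Ω u) with hv
  set G := extendZero Ω (H1.grad Ω u) with hG
  have hvL : MemLp v 2 volume := memLp_extendZero (Lp.memLp _)
  have hGL : MemLp G 2 volume := memLp_extendZero (Lp.memLp _)
  have hvl := hvL.locallyIntegrable (by norm_num)
  have hφ1 : ContDiff ℝ 1 φ := φ.contDiff.of_le (by simp)
  have hφ' : Continuous (partialDeriv k φ) :=
    (hφ1.continuous_fderiv one_ne_zero).clm_apply continuous_const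
  have hφ's : HasCompactSupport (partialDeriv k φ) := φ.hasCompactSupport.fderiv_apply ℝ _
  obtain ⟨C, hC⟩ := φ.continuous.bounded_above_of_compact_support φ.hasCompactSupport
  obtain ⟨N, hN⟩ := eventually_closedBall_subset φ.hasCompactSupport φ.tsupport_subset
  have hFm : ∀ {f : EuclideanSpace ℝ (Fin d) → ℝ}, MemLp f 2 volume →
      MemLp (fun x => smoothAbs ε (f x)) 2 volume := fun hf =>
    hf.mono ((continuous_smoothAbs ε).comp_aestronglyMeasurable hf.1)
      (.of_forall fun x => abs_smoothAbs_le hε _)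
  have hF'm : ∀ {f : EuclideanSpace ℝ (Fin d) → ℝ}, AEStronglyMeasurable f volume →
      MemLp (fun x => f x / √(f x ^ 2 + ε ^ 2) * φ x) 2 volume := fun {f} hf =>
    (φ.continuous.memLp_of_hasCompactSupport φ.hasCompactSupport).mono
      (((continuous_div_sqrt hε).comp_aestronglyMeasurable hf).mul
        φ.continuous.aestronglyMeasurable) (.of_forall fun x => by
        rw [norm_mul]
        exact mul_le_of_le_one_left (norm_nonneg _) (abs_div_sqrt_le (f x)))
  -- For `n ≥ N` the mollification balls about the support of `φ` stay inside `Ω`, so classical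
  -- integration by parts applies and the gradient of the mollified function is the mollified
  -- gradient wherever `φ` does not vanish.
  have step : ∀ n ≥ N, ∫ x, smoothAbs ε (mollify n v x) * partialDeriv k φ x
      = -∫ x, mollify n G x k *
        (mollify n v x / √(mollify n v x ^ 2 + ε ^ 2) * φ x) := by
    intro n hn
    have hs : ContDiff ℝ 1 (mollify n v) := (contDiff_mollify n hvl).of_le (by simp)
    have hd : ∀ x, HasFDerivAt (fun x => smoothAbs ε (mollify n v x))
        ((mollify n v x / √(mollify n v x ^ 2 + ε ^ 2)) • fderiv ℝ (mollify n v) x) x := fun x =>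
      (hasDerivAt_smoothAbs hε _).comp_hasFDerivAt x (hs.differentiable one_ne_zero x).hasFDerivAt
    have hcf : Continuous fun x => smoothAbs ε (mollify n v x) :=
      (continuous_smoothAbs ε).comp hs.continuous
    have hcd : Continuous fun x => fderiv ℝ (fun x => smoothAbs ε (mollify n v x)) x
        (EuclideanSpace.single k (1 : ℝ)) := by
      simp only [fun x => (hd x).fderiv]
      exact (((continuous_div_sqrt hε).comp hs.continuous).smul
        (hs.continuous_fderiv one_ne_zero)).clm_apply continuous_const
    have parts := integral_mul_fderiv_eq_neg_fderiv_mul_of_integrable (μ := volume)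
      (f := fun x => smoothAbs ε (mollify n v x)) (g := φ) (v := EuclideanSpace.single k (1 : ℝ))
      ((hcd.mul φ.continuous).integrable_of_hasCompactSupport φ.hasCompactSupport.mul_left)
      ((hcf.mul hφ').integrable_of_hasCompactSupport hφ's.mul_left)
      ((hcf.mul φ.continuous).integrable_of_hasCompactSupport φ.hasCompactSupport.mul_left)
      (fun x _ => (hd x).differentiableAt) (fun x _ => hφ1.differentiable one_ne_zero x)
    refine parts.trans ?_
    congr 1
    refine integral_congr_ae (.of_forall fun x => ?_)
    simp only [(hd x).fderiv]
    by_cases hx : x ∈ tsupport φ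
    · have := partialDeriv_mollify (u := u) (hN n hn x hx) k
      rw [partialDeriv] at this
      rw [smul_apply, this, smul_eq_mul]
      ring
    · simp [image_eq_zero_of_notMem_tsupport hx]
  have lim1 := tendsto_integral_mul_of_eLpNorm (μ := volume)
    (a := fun n x => smoothAbs ε (mollify n v x)) (a₀ := fun x => smoothAbs ε (v x))
    (b := fun _ => partialDeriv k φ) (b₀ := partialDeriv k φ)
    (fun n => hFm (memLp_mollify n hvL)) (hFm hvL)
    (fun _ => hφ'.memLp_of_hasCompactSupport hφ's) (hφ'.memLp_of_hasCompactSupport hφ's)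
    (tendsto_of_tendsto_of_tendsto_of_le_of_le tendsto_const_nhds (tendsto_eLpNorm_mollify_sub hvL)
      (fun _ => zero_le) (fun n => eLpNorm_mono fun x => abs_smoothAbs_sub_le hε _ _))
    (by simp)
  have lim2 := tendsto_integral_mul_of_eLpNorm (μ := volume)
    (a := fun n x => mollify n G x k) (a₀ := fun x => G x k)
    (b := fun n x => mollify n v x / √(mollify n v x ^ 2 + ε ^ 2) * φ x)
    (b₀ := fun x => v x / √(v x ^ 2 + ε ^ 2) * φ x)
    (fun n => memLp_coord_of_memLp (memLp_mollify n hGL) k) (memLp_coord_of_memLp hGL k)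
    (fun n => hF'm (memLp_mollify n hvL).1) (hF'm hvL.1)
    (tendsto_of_tendsto_of_tendsto_of_le_of_le tendsto_const_nhds (tendsto_eLpNorm_mollify_sub hGL)
      (fun _ => zero_le) (fun n => eLpNorm_mono fun x => by
        exact PiLp.norm_apply_le (mollify n G x - G x) k))
    (by
      have h0 := tendsto_eLpNorm_mollify_sub hvL
      -- `C` bounds `|φ|`, and `1 / ε` is the Lipschitz constant of the derivative of `smoothAbs ε`.
      have h1 : Filter.Tendsto (fun n => ENNReal.ofReal (C / ε) *
          eLpNorm (mollify n v - v) 2 volume) Filter.atTop (nhds 0) := by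
        simpa using ENNReal.Tendsto.const_mul h0 (Or.inr ENNReal.ofReal_ne_top)
      refine tendsto_of_tendsto_of_tendsto_of_le_of_le tendsto_const_nhds h1
        (fun _ => zero_le) (fun n => eLpNorm_le_mul_eLpNorm_of_ae_le_mul (.of_forall fun x => ?_) 2)
      simp only [Pi.sub_apply, ← sub_mul, norm_mul]
      calc _ ≤ (1 / ε * |mollify n v x - v x|) * C := by
            gcongr
            · exact abs_div_sqrt_sub_le hε _ _
            · exact hC x
        _ = C / ε * ‖mollify n v x - v x‖ := by
            rw [Real.norm_eq_abs]
            ring)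
  have heq := tendsto_nhds_unique (lim1.congr' (Filter.eventually_atTop.2 ⟨N, step⟩)) lim2.neg
  have e1 : ∫ x, smoothAbs ε (v x) * partialDeriv k φ x
      = ∫ x in Ω, smoothAbs ε (H1.toL2 Ω u x) * partialDeriv k φ x := by
    rw [← integral_extendZero_mul]
    refine integral_congr_ae (.of_forall fun x => ?_)
    simp only [hv, indicator]
    split_ifs <;> simp [smoothAbs, Real.sqrt_sq hε.le]
  have e2 : ∫ x, G x k * (v x / √(v x ^ 2 + ε ^ 2) * φ x)
      = ∫ x in Ω, H1.toL2 Ω u x / √(H1.toL2 Ω u x ^ 2 + ε ^ 2) * H1.grad Ω u x k * φ x := by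
    rw [← integral_extendZero_mul]
    refine integral_congr_ae (.of_forall fun x => ?_)
    simp only [hv, hG, indicator]
    split_ifs
    · ring
    · simp
  rw [← e1, ← e2, heq]

/-- The weak gradient of `|u|` is `sign(u) ∇u`. -/
lemma integral_abs_mul_partialDeriv (u : H1 Ω) (φ : 𝓓(Ω, ℝ)) (k : Fin d) :
    ∫ x in Ω, |H1.toL2 Ω u x| * partialDeriv k φ x
      = -∫ x in Ω, (SignType.sign (H1.toL2 Ω u x) : ℝ) * H1.grad Ω u x k * φ x := by
  have hu := Lp.memLp (H1.toL2 Ω u)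
  have hpos : ∀ n : ℕ, 0 < 1 / (n + 1 : ℝ) := fun n => by positivity
  have lim1 : Filter.Tendsto (fun n : ℕ => ∫ x in Ω, smoothAbs (1 / (n + 1 : ℝ)) (H1.toL2 Ω u x) *
      partialDeriv k φ x) Filter.atTop
      (nhds (∫ x in Ω, |H1.toL2 Ω u x| * partialDeriv k φ x)) := by
    refine tendsto_integral_of_dominated_convergence
      (fun x => ‖H1.toL2 Ω u x‖ * ‖partialDeriv k φ x‖) (fun n => ?_)
      (hu.norm.integrable_mul (memLp_partialDeriv φ k).norm) (fun n => ?_) ?_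
    · exact ((continuous_smoothAbs _).comp_aestronglyMeasurable hu.1).mul
        (memLp_partialDeriv φ k).1
    · refine .of_forall fun x => ?_
      rw [norm_mul]
      gcongr
      exact abs_smoothAbs_le (hpos n) _
    · exact .of_forall fun x => (tendsto_smoothAbs _).mul_const _
  have lim2 : Filter.Tendsto (fun n : ℕ => ∫ x in Ω, H1.toL2 Ω u x /
      √(H1.toL2 Ω u x ^ 2 + (1 / (n + 1 : ℝ)) ^ 2) * H1.grad Ω u x k * φ x) Filter.atTop
      (nhds (∫ x in Ω, (SignType.sign (H1.toL2 Ω u x) : ℝ) * H1.grad Ω u x k * φ x)) := by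
    refine tendsto_integral_of_dominated_convergence
      (fun x => ‖H1.grad Ω u x k‖ * ‖φ x‖) (fun n => ?_)
      ((memLp_coord (H1.grad Ω u) k).norm.integrable_mul (memLp_testFunction φ).norm)
      (fun n => ?_) ?_
    · exact (((continuous_div_sqrt (hpos n)).comp_aestronglyMeasurable hu.1).mul
        (memLp_coord (H1.grad Ω u) k).1).mul (memLp_testFunction φ).1
    · refine .of_forall fun x => ?_
      rw [norm_mul, norm_mul]
      gcongr
      exact mul_le_of_le_one_left (norm_nonneg _) (abs_div_sqrt_le _)
    · exact .of_forall fun x => ((tendsto_div_sqrt _).mul_const _).mul_const _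
  exact tendsto_nhds_unique (lim1.congr fun n => integral_smoothAbs_mul_partialDeriv (hpos n) u φ k)
    lim2.neg

lemma abs_sign_le_one (x : ℝ) : |(SignType.sign x : ℝ)| ≤ 1 := by
  rcases lt_trichotomy x 0 with h | h | h <;> simp [h]

lemma memLp_sign_smul_grad (u : H1 Ω) :
    MemLp (fun x => (SignType.sign (H1.toL2 Ω u x) : ℝ) • H1.grad Ω u x) 2 (spaceMeasure Ω) := by
  refine (Lp.memLp (H1.grad Ω u)).mono (AEStronglyMeasurable.fun_smul ?_ (Lp.memLp _).1)
    (.of_forall fun x => ?_)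
  · have : Measurable fun x : ℝ => (SignType.sign x : ℝ) := by
      have h : (fun x : ℝ => (SignType.sign x : ℝ))
          = fun x => if 0 < x then 1 else if x < 0 then -1 else 0 := by
        ext x
        rcases lt_trichotomy x 0 with h | h | h <;> simp [h, h.le, not_lt.2]
      rw [h]
      exact Measurable.ite measurableSet_Ioi measurable_const
        (Measurable.ite measurableSet_Iio measurable_const measurable_const)
    exact (this.comp_aemeasurable (Lp.memLp (H1.toL2 Ω u)).1.aemeasurable).aestronglyMeasurable
  · rw [norm_smul]
    exact mul_le_of_le_one_left (norm_nonneg _) (abs_sign_le_one _)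

/-- The absolute value of `u ∈ H¹(Ω)`. -/
def H1.abs (u : H1 Ω) : H1 Ω :=
  H1.mk |H1.toL2 Ω u| (memLp_sign_smul_grad u).toLp (by
    intro φ k
    have e1 : ∫ x in Ω, |H1.toL2 Ω u| x * ParabolicForms.partialDeriv k φ x
        = ∫ x in Ω, |H1.toL2 Ω u x| * ParabolicForms.partialDeriv k φ x := by
      refine integral_congr_ae ?_
      filter_upwards [Lp.coeFn_abs (H1.toL2 Ω u)] with x hx
      rw [hx]
    rw [e1, integral_abs_mul_partialDeriv]
    congr 1
    refine integral_congr_ae ?_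
    filter_upwards [(memLp_sign_smul_grad u).coeFn_toLp] with x hx
    rw [hx]
    simp)

@[simp] lemma H1.toL2_abs (u : H1 Ω) : H1.toL2 Ω u.abs = |H1.toL2 Ω u| := rfl

lemma H1.grad_abs (u : H1 Ω) : H1.grad Ω u.abs =ᵐ[spaceMeasure Ω]
    fun x => (SignType.sign (H1.toL2 Ω u x) : ℝ) • H1.grad Ω u x :=
  (memLp_sign_smul_grad u).coeFn_toLp

lemma H1.norm_abs_le (u : H1 Ω) : ‖u.abs‖ ≤ ‖u‖ := by
  refine H1.norm_le_of_le (by rw [H1.toL2_abs, norm_abs_eq_norm]) ?_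
  refine Lp.norm_le_norm_of_ae_le ?_
  filter_upwards [H1.grad_abs u] with x hx
  rw [hx, norm_smul]
  exact mul_le_of_le_one_left (norm_nonneg _) (abs_sign_le_one _)

/-- The positive part of `u ∈ H¹(Ω)`. -/
def H1.posPart (u : H1 Ω) : H1 Ω := (2⁻¹ : ℝ) • (u + u.abs)

lemma H1.toL2_posPart (u : H1 Ω) : H1.toL2 Ω u.posPart = (H1.toL2 Ω u)⁺ := by
  rw [H1.posPart, map_smul, map_add, H1.toL2_abs, add_abs_eq_two_nsmul_posPart, ← Nat.cast_smul_eq_nsmul ℝ,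
    smul_smul]
  norm_num

/-- Here `θ = (1 + sign u) / 2`, of which only the sign matters later. It equals `1 / 2` on `{u =
0}`, so no information on the gradient there is required. -/
lemma H1.grad_posPart (u : H1 Ω) : ∃ θ : EuclideanSpace ℝ (Fin d) → ℝ, (∀ x, 0 ≤ θ x) ∧
    ∀ᵐ x ∂(spaceMeasure Ω), H1.grad Ω u.posPart x = θ x • H1.grad Ω u x := by
  refine ⟨fun x => 2⁻¹ * (1 + (SignType.sign (H1.toL2 Ω u x) : ℝ)), fun x => ?_, ?_⟩
  · have := (abs_le.1 (abs_sign_le_one (H1.toL2 Ω u x))).1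
    linarith
  · rw [H1.posPart, map_smul, map_add]
    filter_upwards [H1.grad_abs u, Lp.coeFn_smul (2⁻¹ : ℝ) (H1.grad Ω u + H1.grad Ω u.abs),
      Lp.coeFn_add (H1.grad Ω u) (H1.grad Ω u.abs)] with x h1 h2 h3
    rw [h2, Pi.smul_apply, h3, Pi.add_apply, h1, mul_smul, add_smul, one_smul]

lemma H1.norm_posPart_le (u : H1 Ω) : ‖u.posPart‖ ≤ ‖u‖ := by
  rw [H1.posPart, norm_smul]
  have h1 := norm_add_le u u.abs
  have h2 := H1.norm_abs_le u
  norm_num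
  linarith

/-- The infimum of two elements of `H¹(Ω)`. -/
def H1.inf (u v : H1 Ω) : H1 Ω := u - (u - v).posPart

lemma H1.toL2_inf (u v : H1 Ω) : H1.toL2 Ω (u.inf v) = H1.toL2 Ω u ⊓ H1.toL2 Ω v := by
  rw [H1.inf, map_sub, H1.toL2_posPart, map_sub, posPart_def]
  rw [sub_eq_add_neg, neg_sup, add_inf, neg_zero, add_zero, neg_sub, add_sub_cancel, inf_comm]

/-- Continuity of the lattice operations in the `H¹` norm is not needed: this bound, together with
their continuity in `L²`, suffices for `mem_of_bounded_of_tendsto_comp`. -/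
lemma H1.norm_inf_le (u v : H1 Ω) : ‖u.inf v‖ ≤ 2 * ‖u‖ + ‖v‖ := by
  have h1 := norm_sub_le u (u - v).posPart
  have h2 := H1.norm_posPart_le (u - v)
  have h3 := norm_sub_le u v
  rw [H1.inf]
  linarith

end H1

/-! ### The space `H¹₀(Ω)` as an ideal in `H¹(Ω)` -/

/-- A bounded sequence in a closed subspace that converges in a weaker Hilbert norm to an
element of the space has its limit in the subspace. -/
lemma mem_of_bounded_of_tendsto_comp {V H : Type*} [NormedAddCommGroup V] [InnerProductSpace ℝ V]
    [CompleteSpace V] [NormedAddCommGroup H] [InnerProductSpace ℝ H] [CompleteSpace H]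
    {A : V →L[ℝ] H} (hA : Function.Injective A) {W : Submodule ℝ V}
    (hW : IsClosed (W : Set V)) {x : ℕ → V} (hx : ∀ n, x n ∈ W) {C : ℝ} (hC : ∀ n, ‖x n‖ ≤ C)
    {y : V} (hy : Filter.Tendsto (fun n => A (x n)) Filter.atTop (nhds (A y))) : y ∈ W := by
  have : CompleteSpace W := hW.completeSpace_coe
  rw [← Submodule.orthogonal_orthogonal W, Submodule.mem_orthogonal]
  intro p hp
  have hC0 : 0 ≤ C := (norm_nonneg _).trans (hC 0)
  -- Since `A` is injective, `A.adjoint` has dense range. Hence `p` is within `ε` of some `A.adjoint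
  -- q`, whose pairing with `x n` is controlled by the convergence of `A (x n)`; boundedness handles
  -- the remainder.
  have hdense : (LinearMap.range A.adjoint.toLinearMap).topologicalClosure = ⊤ := by
    rw [Submodule.topologicalClosure_eq_top_iff, ContinuousLinearMap.orthogonal_range,
      ContinuousLinearMap.adjoint_adjoint]
    exact LinearMap.ker_eq_bot.2 hA
  have hbound : ∀ ε > 0, |⟪p, y⟫_ℝ| ≤ ε * (‖y‖ + C) := by
    intro ε hε
    have hpc : p ∈ closure (LinearMap.range A.adjoint.toLinearMap : Set V) := by
      rw [← Submodule.topologicalClosure_coe, hdense]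
      trivial
    obtain ⟨_, ⟨q, rfl⟩, hq⟩ := Metric.mem_closure_iff.1 hpc ε hε
    rw [dist_eq_norm] at hq
    have hlim : Filter.Tendsto (fun n => ε * (‖y‖ + C) + ‖q‖ * ‖A y - A (x n)‖) Filter.atTop
        (nhds (ε * (‖y‖ + C))) := by
      have h0 : Filter.Tendsto (fun n => ‖A y - A (x n)‖) Filter.atTop (nhds 0) := by
        simpa using ((tendsto_const_nhds (x := A y)).sub hy).norm
      simpa using (h0.const_mul ‖q‖).const_add (ε * (‖y‖ + C))
    refine ge_of_tendsto' hlim fun n => ?_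
    -- As `p` is orthogonal to `x n`, the vector `y` may be replaced by `y - x n`.
    have e : ⟪p, y⟫_ℝ = ⟪p - A.adjoint q, y - x n⟫_ℝ + ⟪q, A y - A (x n)⟫_ℝ := by
      rw [inner_sub_left, ContinuousLinearMap.adjoint_inner_left, map_sub, sub_add_cancel,
        inner_sub_right, Submodule.inner_left_of_mem_orthogonal (hx n) hp, sub_zero]
    rw [e]
    refine (abs_add_le _ _).trans (add_le_add ((abs_real_inner_le_norm _ _).trans ?_)
      (abs_real_inner_le_norm _ _))
    refine mul_le_mul hq.le ((norm_sub_le _ _).trans ?_) (norm_nonneg _) hε.le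
    have := hC n
    linarith
  have hlim : Filter.Tendsto (fun ε : ℝ => ε * (‖y‖ + C)) (nhdsWithin 0 (Ioi 0)) (nhds 0) := by
    have : Continuous fun ε : ℝ => ε * (‖y‖ + C) := by fun_prop
    simpa using (this.tendsto 0).mono_left nhdsWithin_le_nhds
  have := ge_of_tendsto hlim (Filter.eventually_of_mem self_mem_nhdsWithin hbound)
  exact abs_eq_zero.1 (le_antisymm this (abs_nonneg _))

section H10

variable {d : ℕ} {Ω : TopologicalSpace.Opens (EuclideanSpace ℝ (Fin d))}

lemma isClosed_H10 : IsClosed (H10 Ω : Set (H1 Ω)) := Submodule.isClosed_topologicalClosure _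

/-- The classical gradient of a test function is its weak gradient. -/
lemma isWeakGradient_of_partialDeriv (φ : 𝓓(Ω, ℝ)) {u : L2 Ω} {G : L2Field Ω}
    (hu : u =ᵐ[spaceMeasure Ω] φ)
    (hG : ∀ᵐ x ∂(spaceMeasure Ω), ∀ k, G x k = partialDeriv k φ x) : IsWeakGradient Ω u G := by
  intro ψ k
  have hφ1 : ContDiff ℝ 1 φ := φ.contDiff.of_le (by simp)
  have hψ1 : ContDiff ℝ 1 ψ := ψ.contDiff.of_le (by simp)
  have hd : ∀ {χ : EuclideanSpace ℝ (Fin d) → ℝ}, ContDiff ℝ 1 χ →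
      Continuous fun x => fderiv ℝ χ x (EuclideanSpace.single k (1 : ℝ)) := fun h =>
    (h.continuous_fderiv one_ne_zero).clm_apply continuous_const
  have parts := integral_mul_fderiv_eq_neg_fderiv_mul_of_integrable (μ := volume)
      (f := φ) (g := ψ) (v := EuclideanSpace.single k (1 : ℝ))
      (((hd hφ1).mul ψ.continuous).integrable_of_hasCompactSupport ψ.hasCompactSupport.mul_left)
      ((φ.continuous.mul (hd hψ1)).integrable_of_hasCompactSupport φ.hasCompactSupport.mul_right)
      ((φ.continuous.mul ψ.continuous).integrable_of_hasCompactSupport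
        φ.hasCompactSupport.mul_right)
      (fun x _ => hφ1.differentiable one_ne_zero x) (fun x _ => hψ1.differentiable one_ne_zero x)
  have e1 : ∫ x in Ω, u x * partialDeriv k ψ x = ∫ x, φ x * partialDeriv k ψ x := by
    rw [← setIntegral_eq_integral_of_forall_compl_eq_zero (s := (Ω : Set _))
      (f := fun x => φ x * partialDeriv k ψ x) fun x hx => by
        rw [image_eq_zero_of_notMem_tsupport fun h => hx (φ.tsupport_subset h), zero_mul]]
    refine integral_congr_ae ?_
    filter_upwards [hu] with x hx
    rw [hx]
  have e2 : ∫ x in Ω, G x k * ψ x = ∫ x, partialDeriv k φ x * ψ x := by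
    rw [← setIntegral_eq_integral_of_forall_compl_eq_zero (s := (Ω : Set _))
      (f := fun x => partialDeriv k φ x * ψ x) fun x hx => by
        rw [image_eq_zero_of_notMem_tsupport fun h => hx (ψ.tsupport_subset h), mul_zero]]
    refine integral_congr_ae ?_
    filter_upwards [hG] with x hx
    rw [hx]
  rw [e1, e2]
  exact parts

/-- Functions in `H¹(Ω)` vanishing outside a compact subset of `Ω` belong to `H¹₀(Ω)`. -/
theorem mem_H10_of_compact {K : Set (EuclideanSpace ℝ (Fin d))} (hK : IsCompact K) (hKΩ : K ⊆ Ω)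
    {w : H1 Ω} (hw : ∀ᵐ x ∂(spaceMeasure Ω), x ∉ K → H1.toL2 Ω w x = 0) : w ∈ H10 Ω := by
  obtain ⟨δ, hδ, hδΩ⟩ := hK.exists_cthickening_subset_open Ω.isOpen hKΩ
  obtain ⟨N, hN⟩ := Filter.eventually_atTop.1
    (tendsto_one_div_nat_succ.eventually (gt_mem_nhds (half_pos hδ)))
  set v := extendZero Ω (H1.toL2 Ω w) with hv
  set G := extendZero Ω (H1.grad Ω w) with hG
  have hvL : MemLp v 2 volume := memLp_extendZero (Lp.memLp _)
  have hGL : MemLp G 2 volume := memLp_extendZero (Lp.memLp _)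
  have hgw : ∀ᵐ x ∂(spaceMeasure Ω), x ∈ (Ω : Set _) \ K → H1.grad Ω w x = 0 :=
    H1.grad_ae_eq_zero (Ω.isOpen.sdiff hK.isClosed) sdiff_subset (by
      filter_upwards [hw] with x hx h using hx h.2)
  have hv0 : ∀ᵐ x, x ∉ K → v x = 0 := by
    filter_upwards [(ae_restrict_iff' Ω.isOpen.measurableSet).1 hw] with x hx hxK
    simp only [hv, indicator]
    split_ifs with h
    exacts [hx h hxK, rfl]
  have hG0 : ∀ᵐ x, x ∉ K → G x = 0 := by
    filter_upwards [(ae_restrict_iff' Ω.isOpen.measurableSet).1 hgw] with x hx hxK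
    simp only [hG, indicator]
    split_ifs with h
    exacts [hx h ⟨h, hxK⟩, rfl]
  -- With mollification radius below `δ / 2`, supports stay in `S`, and balls about points of `S`
  -- stay in the `δ`-thickening of `K`, hence in `Ω`.
  set S := Metric.cthickening (δ / 2) K with hS
  have hSc : IsCompact S := hK.cthickening
  have hSΩ : S ⊆ Ω := (Metric.cthickening_mono (by linarith) K).trans hδΩ
  have hball : ∀ n ≥ N, ∀ x ∉ S, ∀ t ∈ Metric.ball x (1 / (n + 1 : ℝ)), t ∉ K := by
    intro n hn x hx t ht htK
    refine hx (Metric.mem_cthickening_of_dist_le x t _ K htK ?_)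
    rw [dist_comm]
    exact (le_of_lt ht).trans (hN n hn).le
  have hsupp : ∀ n ≥ N, tsupport (mollify n v) ⊆ S := by
    intro n hn
    refine closure_minimal (fun x hx => ?_) hSc.isClosed
    by_contra h
    refine hx (mollify_eq_zero ?_)
    filter_upwards [hv0] with t ht htb using ht (hball n hn x h t htb)
  -- On `S` this is the commutation of mollification with differentiation; off `S` both sides
  -- vanish.
  have hgrad : ∀ n ≥ N, ∀ x k, mollify n G x k = partialDeriv k (mollify n v) x := by
    intro n hn x k
    by_cases hx : x ∈ S
    · refine (partialDeriv_mollify (fun t ht => hδΩ ?_) k).symm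
      have h1 := Metric.mem_cthickening_of_dist_le t x (1 / (n + 1 : ℝ)) S hx ht
      refine Metric.cthickening_mono ?_ K
        (Metric.cthickening_cthickening_subset (by positivity) (by linarith) K h1)
      linarith [hN n hn]
    · rw [partialDeriv, fderiv_of_notMem_tsupport ℝ fun h => hx (hsupp n hn h), mollify_eq_zero]
      · rfl
      · filter_upwards [hG0] with t ht htb using ht (hball n hn x hx t htb)
  have hmv : ∀ n, MemLp (mollify n v) 2 (spaceMeasure Ω) := fun n => (memLp_mollify n hvL).restrict _
  have hmG : ∀ n, MemLp (mollify n G) 2 (spaceMeasure Ω) := fun n => (memLp_mollify n hGL).restrict _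
  let φ : ∀ n, N ≤ n → 𝓓(Ω, ℝ) := fun n hn =>
    mkTest (mollify n v) (contDiff_mollify n (hvL.locallyIntegrable (by norm_num)))
      (HasCompactSupport.of_support_subset_isCompact hSc
        ((subset_tsupport _).trans (hsupp n hn))) ((hsupp n hn).trans hSΩ)
  let x : ℕ → H1 Ω := fun n =>
    H1.mk (hmv (N + n)).toLp (hmG (N + n)).toLp
      (isWeakGradient_of_partialDeriv (φ (N + n) (by omega)) (hmv _).coeFn_toLp (by
        filter_upwards [(hmG (N + n)).coeFn_toLp] with x hx k
        rw [hx]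
        exact hgrad _ (by omega) x k))
  have hxn : ∀ n, x n ∈ H10 Ω := fun n =>
    (testSubmodule Ω).le_topologicalClosure ⟨φ (N + n) (by omega), (hmv _).coeFn_toLp⟩
  have key : ∀ {X : Type} [NormedAddCommGroup X] [NormedSpace ℝ X] [CompleteSpace X]
      {f : EuclideanSpace ℝ (Fin d) → X} (hf : MemLp f 2 volume)
      (hm : ∀ n, MemLp (mollify n f) 2 (spaceMeasure Ω)) (g : Lp X 2 (spaceMeasure Ω)),
      f =ᵐ[spaceMeasure Ω] g →
      Filter.Tendsto (fun n => (hm n).toLp) Filter.atTop (nhds g) := by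
    intro X _ _ _ f hf hm g hfg
    rw [Lp.tendsto_Lp_iff_tendsto_eLpNorm']
    refine tendsto_of_tendsto_of_tendsto_of_le_of_le tendsto_const_nhds
      (tendsto_eLpNorm_mollify_sub hf) (fun _ => zero_le) fun n => ?_
    calc _ = eLpNorm (mollify n f - f) 2 (spaceMeasure Ω) := by
          refine eLpNorm_congr_ae ?_
          filter_upwards [(hm n).coeFn_toLp, hfg] with x h1 h2
          simp [h1, h2]
      _ ≤ _ := eLpNorm_mono_measure _ Measure.restrict_le_self
  have hvw : v =ᵐ[spaceMeasure Ω] H1.toL2 Ω w := indicator_ae_eq_restrict Ω.isOpen.measurableSet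
  have hGw : G =ᵐ[spaceMeasure Ω] H1.grad Ω w := indicator_ae_eq_restrict Ω.isOpen.measurableSet
  have hadd : Filter.Tendsto (fun n => N + n) Filter.atTop Filter.atTop :=
    Filter.tendsto_atTop_mono (fun n => Nat.le_add_left n N) Filter.tendsto_id
  have h1 : Filter.Tendsto (fun n => H1.toL2 Ω (x n)) Filter.atTop (nhds (H1.toL2 Ω w)) :=
    (key hvL hmv _ hvw).comp hadd
  have h2 : Filter.Tendsto (fun n => H1.grad Ω (x n)) Filter.atTop (nhds (H1.grad Ω w)) :=
    (key hGL hmG _ hGw).comp hadd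
  have hx : Filter.Tendsto x Filter.atTop (nhds w) := by
    rw [tendsto_iff_norm_sub_tendsto_zero]
    have h3 : Filter.Tendsto (fun n => ‖x n - w‖ ^ 2) Filter.atTop (nhds 0) := by
      simp only [H1.norm_sq, map_sub]
      simpa using ((tendsto_iff_norm_sub_tendsto_zero.1 h1).pow 2).add
        ((tendsto_iff_norm_sub_tendsto_zero.1 h2).pow 2)
    simpa [Real.sqrt_sq] using h3.sqrt
  exact isClosed_H10.mem_of_tendsto hx (.of_forall hxn)

/-- `H¹₀(Ω)` is an ideal in `H¹(Ω)`. -/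
theorem mem_H10_of_le_abs {w g : H1 Ω} (hg : g ∈ H10 Ω) (hw0 : 0 ≤ H1.toL2 Ω w)
    (hw : H1.toL2 Ω w ≤ |H1.toL2 Ω g|) : w ∈ H10 Ω := by
  obtain ⟨p, hp, hpg⟩ := mem_closure_iff_seq_limit.1
    (show g ∈ closure (testSubmodule Ω : Set (H1 Ω)) from hg)
  obtain ⟨C, hC⟩ := hpg.norm.bddAbove_range
  -- With test functions `p n → g`, the truncations `w ⊓ |p n|` vanish off a compact subset of `Ω`,
  -- stay bounded in `H¹`, and converge in `L²` to `w ⊓ |g| = w`.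
  refine mem_of_bounded_of_tendsto_comp H1.toL2_injective isClosed_H10
    (x := fun n => w.inf (p n).abs) (C := 2 * ‖w‖ + C) (fun n => ?_) (fun n => ?_) ?_
  · obtain ⟨φ, hφ⟩ := hp n
    refine mem_H10_of_compact φ.hasCompactSupport φ.tsupport_subset ?_
    have e : H1.toL2 Ω (w.inf (p n).abs) = H1.toL2 Ω w ⊓ |H1.toL2 Ω (p n)| := by
      rw [H1.toL2_inf, H1.toL2_abs]
    rw [e]
    filter_upwards [hφ, Lp.coeFn_inf (H1.toL2 Ω w) |H1.toL2 Ω (p n)|,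
      Lp.coeFn_abs (H1.toL2 Ω (p n)), (Lp.coeFn_nonneg _).2 hw0] with x h1 h2 h3 h4 hx
    rw [h2, Pi.inf_apply, h3, h1, image_eq_zero_of_notMem_tsupport hx, abs_zero]
    exact inf_eq_right.2 h4
  · have h1 := H1.norm_inf_le w (p n).abs
    have h2 := H1.norm_abs_le (p n)
    have h3 : ‖p n‖ ≤ C := hC ⟨n, rfl⟩
    linarith
  · have h1 : Filter.Tendsto (fun n => H1.toL2 Ω w ⊓ |H1.toL2 Ω (p n)|) Filter.atTop
        (nhds (H1.toL2 Ω w ⊓ |H1.toL2 Ω g|)) := by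
      have : Filter.Tendsto (fun n => H1.toL2 Ω (p n)) Filter.atTop (nhds (H1.toL2 Ω g)) :=
        ((H1.toL2 Ω).continuous.tendsto g).comp hpg
      have hc : Continuous fun y : L2 Ω => H1.toL2 Ω w ⊓ (y ⊔ -y) :=
        continuous_const.inf (continuous_id.sup continuous_neg)
      exact (hc.tendsto _).comp this
    rw [inf_eq_left.2 hw] at h1
    simpa only [H1.toL2_inf, H1.toL2_abs] using h1

end H10

/-! ### Positivity and comparison -/

section Comparison

variable {d : ℕ} {Ω : TopologicalSpace.Opens (EuclideanSpace ℝ (Fin d))}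

lemma coeFn_posPart_L2 (y : L2 Ω) : (y⁺ : L2 Ω) =ᵐ[spaceMeasure Ω] fun x => max (y x) 0 := by
  rw [posPart_def]
  filter_upwards [Lp.coeFn_sup y 0, Lp.coeFn_zero ℝ 2 (spaceMeasure Ω)] with x h1 h2
  rw [h1, Pi.sup_apply, h2]
  rfl

/-- `y⁺` is a subgradient of `y ↦ ‖y⁺‖² / 2` on `L²(Ω)`. -/
lemma half_norm_posPart_sq_sub_le (x y : L2 Ω) :
    2⁻¹ * ‖y⁺‖ ^ 2 - 2⁻¹ * ‖x⁺‖ ^ 2 ≤ ⟪y - x, y⁺⟫_ℝ := by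
  -- Pointwise the integrand is `½ (y⁺ - x⁺)² + (x⁺ - x) y⁺`, a sum of nonnegative terms.
  have h : 0 ≤ ⟪y - x, y⁺⟫_ℝ - 2⁻¹ * ⟪y⁺, y⁺⟫_ℝ + 2⁻¹ * ⟪x⁺, x⁺⟫_ℝ := by
    simp only [L2.inner_def]
    rw [← integral_const_mul, ← integral_const_mul, ← integral_sub, ← integral_add]
    · refine integral_nonneg_of_ae ?_
      filter_upwards [coeFn_posPart_L2 x, coeFn_posPart_L2 y, Lp.coeFn_sub y x] with s h1 h2 h3
      simp only [h1, h2, h3, Pi.sub_apply, Pi.zero_apply, RCLike.inner_apply, conj_trivial]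
      rcases max_cases (x s) 0 with ⟨h, h'⟩ | ⟨h, h'⟩ <;>
        rcases max_cases (y s) 0 with ⟨k, k'⟩ | ⟨k, k'⟩ <;> rw [h, k] <;>
        nlinarith [sq_nonneg (x s - y s), sq_nonneg (x s), sq_nonneg (y s)]
    · exact (L2.integrable_inner _ _).sub ((L2.integrable_inner _ _).const_mul _)
    · exact (L2.integrable_inner _ _).const_mul _
    · exact L2.integrable_inner _ _
    · exact (L2.integrable_inner _ _).const_mul _
  rw [real_inner_self_eq_norm_sq, real_inner_self_eq_norm_sq] at h
  linarith

lemma continuous_posPart_L2 : Continuous fun y : L2 Ω => y⁺ := by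
  simp only [posPart_def]
  exact continuous_id.sup continuous_const

/-- A curve in `L²(Ω)` starting in the negative cone stays there if its derivative is
nonpositive when tested with its positive part. -/
lemma nonpos_of_deriv_posPart_nonpos {V : Type*} [NormedAddCommGroup V] [InnerProductSpace ℝ V]
    {j : V →L[ℝ] L2 Ω} {T : ℝ} {z : ℝ → L2 Ω} (hz : ContinuousOn z (Icc 0 T))
    {g : ℝ → StrongDual ℝ V} (hg : MemLp g 2 (timeMeasure T))
    (hzg : ∀ w, ∀ s ∈ Icc 0 T, ∀ t ∈ Icc 0 T, ⟪z t - z s, j w⟫_ℝ = ∫ r in s..t, g r w)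
    {m : ℝ → ℝ} (hm : MemLp m 2 (timeMeasure T))
    (hw : ∀ᵐ t ∂(timeMeasure T), ∃ w : V, j w = (z t)⁺ ∧ ‖w‖ ≤ m t ∧ g t w ≤ 0)
    (hz0 : z 0 ≤ 0) : ∀ t ∈ Icc 0 T, z t ≤ 0 := by
  intro t ht
  have h := le_initial_of_subgradient hz hg hzg hm (Φ := fun y : L2 Ω => 2⁻¹ * ‖y⁺‖ ^ 2)
    ((continuous_posPart_L2.norm.pow 2).const_mul _) half_norm_posPart_sq_sub_le hw t ht
  simp only [posPart_eq_zero.2 hz0] at h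
  rw [← posPart_eq_zero, ← norm_eq_zero]
  have : ‖(z t)⁺‖ ^ 2 ≤ 0 := by
    rw [norm_zero] at h
    linarith
  exact pow_eq_zero_iff two_ne_zero |>.1 (le_antisymm this (sq_nonneg _))

/-- Measurable bounded nonnegative coefficients at a fixed time. -/
structure IsAccretiveAt (Ω : TopologicalSpace.Opens (EuclideanSpace ℝ (Fin d)))
    (a : Fin d → Fin d → ℝ → EuclideanSpace ℝ (Fin d) → ℝ) (M t : ℝ) : Prop where
  meas : ∀ k j, AEStronglyMeasurable (a k j t) (spaceMeasure Ω)
  bdd : ∀ k j, ∀ x ∈ Ω, |a k j t x| ≤ M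
  nonneg : ∀ᵐ x ∂(spaceMeasure Ω), ∀ ξ : EuclideanSpace ℝ (Fin d),
    0 ≤ ∑ k, ∑ j, a k j t x * ξ k * ξ j

variable {a : Fin d → Fin d → ℝ → EuclideanSpace ℝ (Fin d) → ℝ} {M t T : ℝ}

lemma IsAccretiveAt.integrable (h : IsAccretiveAt Ω a M t) (u v : H1 Ω) (k j : Fin d) :
    Integrable (fun x => a k j t x * H1.partialDeriv k u x * H1.partialDeriv j v x)
      (spaceMeasure Ω) := by
  have h1 := ((memLp_coord (H1.grad Ω u) k).integrable_mul (memLp_coord (H1.grad Ω v) j)).bdd_mul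
    (c := M) (h.meas k j) (by
      filter_upwards [ae_restrict_mem Ω.isOpen.measurableSet] with x hx using h.bdd k j x hx)
  refine h1.congr (.of_forall fun x => ?_)
  simp [H1.partialDeriv, mul_assoc]

lemma IsAccretiveAt.ellipticForm_sub (h : IsAccretiveAt Ω a M t) (u v w : H1 Ω) :
    ellipticForm a t (u - v) w = ellipticForm a t u w - ellipticForm a t v w := by
  simp only [ellipticForm, ← Finset.sum_sub_distrib]
  refine Finset.sum_congr rfl fun k _ => Finset.sum_congr rfl fun j _ => ?_
  rw [← integral_sub (h.integrable u w k j) (h.integrable v w k j)]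
  refine integral_congr_ae ?_
  filter_upwards [Lp.coeFn_sub (H1.grad Ω u) (H1.grad Ω v)] with x hx
  simp only [H1.partialDeriv, map_sub, hx, Pi.sub_apply, PiLp.sub_apply]
  ring

lemma IsAccretiveAt.ellipticForm_neg (h : IsAccretiveAt Ω a M t) (u w : H1 Ω) :
    ellipticForm a t (-u) w = -ellipticForm a t u w := by
  have h0 : ellipticForm a t (0 : H1 Ω) w = 0 := by
    simpa using h.ellipticForm_sub u u w
  rw [← zero_sub, h.ellipticForm_sub, h0, zero_sub]

/-- As the gradient of `u⁺` is `θ ∇u`, the integrand is `θ ≥ 0` times the quadratic form at `∇u`. -/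
lemma IsAccretiveAt.ellipticForm_posPart_nonneg (h : IsAccretiveAt Ω a M t) (u : H1 Ω) :
    0 ≤ ellipticForm a t u u.posPart := by
  obtain ⟨θ, hθ0, hθ⟩ := H1.grad_posPart u
  have e : ellipticForm a t u u.posPart
      = ∫ x in Ω, ∑ k, ∑ j, a k j t x * H1.partialDeriv k u x * H1.partialDeriv j u.posPart x := by
    rw [integral_finsetSum _ fun k _ => integrable_finsetSum _ fun j _ => h.integrable _ _ k j]
    refine Finset.sum_congr rfl fun k _ => ?_
    rw [integral_finsetSum _ fun j _ => h.integrable _ _ k j]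
  rw [e]
  refine integral_nonneg_of_ae ?_
  filter_upwards [hθ, h.nonneg] with x h1 h2
  have h3 := mul_nonneg (hθ0 x) (h2 (H1.grad Ω u x))
  rw [Finset.mul_sum] at h3
  refine h3.trans_eq (Finset.sum_congr rfl fun k _ => ?_)
  rw [Finset.mul_sum]
  refine Finset.sum_congr rfl fun j _ => ?_
  simp only [H1.partialDeriv, h1, PiLp.smul_apply, smul_eq_mul]
  ring

/-- Elliptic coefficients are accretive at almost every time. -/
lemma ae_isAccretiveAt
    (ha_meas : ∀ k j, AEMeasurable (fun p : ℝ × EuclideanSpace ℝ (Fin d) => a k j p.1 p.2)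
      (volume.restrict (Icc 0 T ×ˢ (Ω : Set (EuclideanSpace ℝ (Fin d))))))
    (ha_bdd : ∀ k j, ∀ t ∈ Icc 0 T, ∀ x ∈ Ω, |a k j t x| ≤ M)
    {η : ℝ} (hη : 0 < η)
    (ha_ell : ∀ᵐ p : ℝ × EuclideanSpace ℝ (Fin d)
      ∂(volume.restrict (Icc 0 T ×ˢ (Ω : Set (EuclideanSpace ℝ (Fin d))))),
      ∀ ξ : EuclideanSpace ℝ (Fin d),
        η * ‖ξ‖ ^ 2 ≤ ∑ k, ∑ j, a k j p.1 p.2 * ξ k * ξ j) :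
    ∀ᵐ t ∂(timeMeasure T), IsAccretiveAt Ω a M t := by
  have hμ : (volume.restrict (Icc 0 T ×ˢ (Ω : Set (EuclideanSpace ℝ (Fin d)))) :
      Measure (ℝ × EuclideanSpace ℝ (Fin d)))
      = (volume.restrict (Icc 0 T)).prod (spaceMeasure Ω) := by
    rw [Measure.prod_restrict, Measure.volume_eq_prod]
  rw [hμ] at ha_ell
  have h1 := ae_restrict_of_ae_restrict_of_subset Ioo_subset_Icc_self
    (Measure.ae_ae_of_ae_prod ha_ell)
  -- Sections of a jointly a.e. measurable function need not be measurable for every `t`; Fubini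
  -- compares them with sections of a measurable representative for a.e. `t`.
  have h2 : ∀ k j, ∀ᵐ t ∂(timeMeasure T), AEStronglyMeasurable (a k j t) (spaceMeasure Ω) := by
    intro k j
    have hm := ha_meas k j
    rw [hμ] at hm
    filter_upwards [ae_restrict_of_ae_restrict_of_subset Ioo_subset_Icc_self
      (Measure.ae_ae_of_ae_prod hm.ae_eq_mk)] with t ht
    exact AEMeasurable.aestronglyMeasurable
      ⟨_, hm.measurable_mk.comp measurable_prodMk_left, ht⟩
  filter_upwards [h1, ae_all_iff.2 fun k => ae_all_iff.2 (h2 k),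
    ae_restrict_mem measurableSet_Ioo] with t h3 h4 h5
  refine ⟨h4, fun k j => ha_bdd k j t (Ioo_subset_Icc_self h5), ?_⟩
  filter_upwards [h3] with x hx ξ
  exact (by positivity : 0 ≤ η * ‖ξ‖ ^ 2).trans (hx ξ)

/-- The null set in the hypothesis depends on `v`. The nonnegative cone is separable, so countably
many `v` suffice, and continuity of `f t` gives the rest. -/
lemma ae_forall_nonneg {f : ℝ → StrongDual ℝ (H1 Ω)}
    (hf : ∀ v : H1 Ω, 0 ≤ H1.toL2 Ω v → ∀ᵐ t ∂(timeMeasure T), 0 ≤ f t v) :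
    ∀ᵐ t ∂(timeMeasure T), ∀ v : H1 Ω, 0 ≤ H1.toL2 Ω v → 0 ≤ f t v := by
  let C := {v : H1 Ω // 0 ≤ H1.toL2 Ω v}
  have : Nonempty C := ⟨⟨0, by rw [map_zero]⟩⟩
  filter_upwards [ae_all_iff.2 fun n => hf _ (TopologicalSpace.denseSeq C n).2] with t ht v hv
  exact (TopologicalSpace.denseRange_denseSeq C).induction_on (p := fun v : C => 0 ≤ f t v.1)
    ⟨v, hv⟩ (isClosed_le continuous_const ((f t).continuous.comp continuous_subtype_val)) ht

lemma memLp_comp_dual {V W : Type*} [NormedAddCommGroup V] [NormedSpace ℝ V]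
    [NormedAddCommGroup W] [NormedSpace ℝ W] (i : W →L[ℝ] V) {g : ℝ → StrongDual ℝ V}
    {μ : Measure ℝ} (hg : MemLp g 2 μ) : MemLp (fun t => (g t).comp i) 2 μ :=
  ((ContinuousLinearMap.compL ℝ W V ℝ).flip i).comp_memLp' hg

variable {f : ℝ → StrongDual ℝ (H1 Ω)} {u₀ : L2 Ω} {u uD uN : ℝ → L2 Ω}

/-- With `w = (-v)⁺`, the equation gives `⟨-v', w⟩ = -⟨f, w⟩ - 𝔞(t, -v, w)`, and both terms are
nonpositive. -/
theorem IsNeumannSolution.nonneg (hT : 0 < T)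
    (ha : ∀ᵐ t ∂(timeMeasure T), IsAccretiveAt Ω a M t)
    (hf : ∀ᵐ t ∂(timeMeasure T), ∀ v : H1 Ω, 0 ≤ H1.toL2 Ω v → 0 ≤ f t v) (hu₀ : 0 ≤ u₀)
    (hu : IsNeumannSolution T a f u₀ u) : ∀ t ∈ Icc 0 T, 0 ≤ u t := by
  obtain ⟨hc, h0, v, dv, hv, huv, heq⟩ := hu
  have h := nonpos_of_deriv_posPart_nonpos (z := -u) (j := H1.toL2 Ω) (g := -dv) hc.neg
    hv.memLp_deriv.neg (fun w s hs t ht => by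
      have := hv.inner_sub_eq_integral hT hc huv w s hs t ht
      simp only [Pi.neg_apply, neg_apply, intervalIntegral.integral_neg, ← this]
      rw [← inner_neg_left]
      congr 1
      abel) hv.memLp.norm (by
      filter_upwards [ha, hf, huv, heq] with t h1 h2 h3 h4
      refine ⟨(-v t).posPart, ?_, (H1.norm_posPart_le _).trans_eq (norm_neg _), ?_⟩
      · rw [H1.toL2_posPart, map_neg, Pi.neg_apply, h3]
      · have h5 := h4 (-v t).posPart
        have h6 := h1.ellipticForm_posPart_nonneg (-v t)
        have h7 := h2 (-v t).posPart (by rw [H1.toL2_posPart]; exact posPart_nonneg _)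
        rw [h1.ellipticForm_neg] at h6
        simp only [Pi.neg_apply, neg_apply]
        linarith) (by simpa [h0] using hu₀)
  intro t ht
  simpa using h t ht

/-- The same test function is admissible because `(-v)⁺ ≤ |v|` and `H¹₀(Ω)` is an ideal. -/
theorem IsDirichletSolution.nonneg (hT : 0 < T)
    (ha : ∀ᵐ t ∂(timeMeasure T), IsAccretiveAt Ω a M t)
    (hf : ∀ᵐ t ∂(timeMeasure T), ∀ v : H1 Ω, 0 ≤ H1.toL2 Ω v → 0 ≤ f t v) (hu₀ : 0 ≤ u₀)
    (hu : IsDirichletSolution T a f u₀ u) : ∀ t ∈ Icc 0 T, 0 ≤ u t := by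
  obtain ⟨hc, h0, v, dv, hv, huv, heq⟩ := hu
  have h := nonpos_of_deriv_posPart_nonpos (z := -u) (j := H10.toL2 Ω) (g := -dv) hc.neg
    hv.memLp_deriv.neg (fun w s hs t ht => by
      have := hv.inner_sub_eq_integral hT hc huv w s hs t ht
      simp only [Pi.neg_apply, neg_apply, intervalIntegral.integral_neg, ← this]
      rw [← inner_neg_left]
      congr 1
      abel) hv.memLp.norm (by
      filter_upwards [ha, hf, huv, heq] with t h1 h2 h3 h4
      set y : H1 Ω := (v t : H1 Ω) with hy
      have hmem : (-y).posPart ∈ H10 Ω := by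
        refine mem_H10_of_le_abs (v t).2 ?_ ?_
        · rw [H1.toL2_posPart]
          exact posPart_nonneg _
        · rw [H1.toL2_posPart, map_neg, posPart_def, ← hy]
          exact sup_le (neg_le_abs _) (abs_nonneg _)
      refine ⟨⟨(-y).posPart, hmem⟩, ?_, (H1.norm_posPart_le _).trans_eq (norm_neg _), ?_⟩
      · change H1.toL2 Ω (-y).posPart = _
        rw [H1.toL2_posPart, map_neg, Pi.neg_apply, h3]
        rfl
      · have h5 := h4 ⟨(-y).posPart, hmem⟩
        have h6 := h1.ellipticForm_posPart_nonneg (-y)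
        have h7 := h2 (-y).posPart (by rw [H1.toL2_posPart]; exact posPart_nonneg _)
        rw [h1.ellipticForm_neg] at h6
        simp only [ContinuousLinearMap.comp_apply, Submodule.subtypeL_apply] at h5
        simp only [Pi.neg_apply, neg_apply]
        linarith) (by simpa [h0] using hu₀)
  intro t ht
  simpa using h t ht

/-- Nonnegativity of `uN` gives `(uD - uN)⁺ ≤ |uD|`, so this positive part lies in `H¹₀(Ω)` and may
be tested in both equations. Subtracting them cancels `f` and leaves `-𝔞(t, y, y⁺) ≤ 0` with `y = vD
- vN`. -/
theorem IsDirichletSolution.le_neumann (hT : 0 < T)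
    (ha : ∀ᵐ t ∂(timeMeasure T), IsAccretiveAt Ω a M t)
    (huD : IsDirichletSolution T a f u₀ uD) (huN : IsNeumannSolution T a f u₀ uN)
    (hN : ∀ t ∈ Icc 0 T, 0 ≤ uN t) : ∀ t ∈ Icc 0 T, uD t ≤ uN t := by
  obtain ⟨hcD, h0D, vD, dvD, hvD, huvD, heqD⟩ := huD
  obtain ⟨hcN, h0N, vN, dvN, hvN, huvN, heqN⟩ := huN
  have hgN := memLp_comp_dual (H10 Ω).subtypeL hvN.memLp_deriv
  have hwD : MemLp (fun t => (vD t : H1 Ω)) 2 (timeMeasure T) :=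
    hvD.memLp.continuousLinearMap_comp (H10 Ω).subtypeL
  have h := nonpos_of_deriv_posPart_nonpos (z := uD - uN) (j := H10.toL2 Ω)
    -- The Neumann derivative is restricted to `H¹₀(Ω)`, the only space on which both equations can
    -- be tested.
    (g := fun t => dvD t - (dvN t).comp (H10 Ω).subtypeL) (hcD.sub hcN)
    (hvD.memLp_deriv.sub hgN) (fun w s hs t ht => by
      have h1 := hvD.inner_sub_eq_integral hT hcD huvD w s hs t ht
      have h2 := hvN.inner_sub_eq_integral hT hcN huvN (w : H1 Ω) s hs t ht
      have hii : ∀ {g : ℝ → ℝ}, IntegrableOn g (Ioo 0 T) → IntervalIntegrable g volume s t := by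
        intro g hg
        rw [← integrableOn_Icc_iff_integrableOn_Ioo] at hg
        exact (hg.mono_set (uIcc_subset_Icc hs ht)).intervalIntegrable
      simp only [sub_apply, ContinuousLinearMap.comp_apply, Submodule.subtypeL_apply, Pi.sub_apply]
      rw [intervalIntegral.integral_sub, ← h1, ← h2]
      · change _ = _ - ⟪uN t - uN s, H10.toL2 Ω w⟫_ℝ
        rw [← inner_sub_left]
        congr 1
        abel
      · exact hii ((hvD.memLp_deriv.integrable (by norm_num)).apply_continuousLinearMap w)
      · exact hii ((hvN.memLp_deriv.integrable (by norm_num)).apply_continuousLinearMap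
          (w : H1 Ω))) (hwD.sub hvN.memLp).norm (by
      filter_upwards [ha, huvD, heqD, huvN, heqN, ae_restrict_mem measurableSet_Ioo]
        with t h1 h2 h3 h4 h5 ht
      have hN' : 0 ≤ H1.toL2 Ω (vN t) := h4 ▸ hN t (Ioo_subset_Icc_self ht)
      set y : H1 Ω := (vD t : H1 Ω) with hy
      have hmem : (y - vN t).posPart ∈ H10 Ω := by
        refine mem_H10_of_le_abs (vD t).2 ?_ ?_
        · rw [H1.toL2_posPart]
          exact posPart_nonneg _
        · rw [H1.toL2_posPart, map_sub, posPart_def, ← hy]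
          exact sup_le ((sub_le_self _ hN').trans (le_abs_self _)) (abs_nonneg _)
      refine ⟨⟨(y - vN t).posPart, hmem⟩, ?_, H1.norm_posPart_le _, ?_⟩
      · change H1.toL2 Ω (y - vN t).posPart = _
        rw [H1.toL2_posPart, map_sub, Pi.sub_apply, h2, h4]
        rfl
      · have h6 := h3 ⟨(y - vN t).posPart, hmem⟩
        have h7 := h5 (y - vN t).posPart
        have h8 := h1.ellipticForm_posPart_nonneg (y - vN t)
        rw [h1.ellipticForm_sub] at h8
        simp only [ContinuousLinearMap.comp_apply, Submodule.subtypeL_apply] at h6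
        simp only [sub_apply, ContinuousLinearMap.comp_apply, Submodule.subtypeL_apply]
        linarith) (by simp [h0D, h0N])
  intro t ht
  simpa using h t ht

end Comparison

end ParabolicForms
end

theorem mainTheorem7 {d : ℕ} (Ω : TopologicalSpace.Opens (EuclideanSpace ℝ (Fin d)))
    (T : ℝ) (hT : 0 < T)
    (a : Fin d → Fin d → ℝ → EuclideanSpace ℝ (Fin d) → ℝ)
    (ha_meas : ∀ k j, AEMeasurable (fun p : ℝ × EuclideanSpace ℝ (Fin d) => a k j p.1 p.2)
      (volume.restrict (Icc 0 T ×ˢ (Ω : Set (EuclideanSpace ℝ (Fin d))))))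
    (M : ℝ) (ha_bdd : ∀ k j, ∀ t ∈ Icc 0 T, ∀ x ∈ Ω, |a k j t x| ≤ M)
    (η : ℝ) (hη : 0 < η)
    (ha_ell : ∀ᵐ p : ℝ × EuclideanSpace ℝ (Fin d)
      ∂(volume.restrict (Icc 0 T ×ˢ (Ω : Set (EuclideanSpace ℝ (Fin d))))),
      ∀ ξ : EuclideanSpace ℝ (Fin d),
        η * ‖ξ‖ ^ 2 ≤ ∑ k, ∑ j, a k j p.1 p.2 * ξ k * ξ j)
    (f : ℝ → StrongDual ℝ (ParabolicForms.H1 Ω))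
    (hf : MemLp f 2 (ParabolicForms.timeMeasure T))
    (hf_nonneg : ∀ v : ParabolicForms.H1 Ω, 0 ≤ ParabolicForms.H1.toL2 Ω v →
      ∀ᵐ t ∂(ParabolicForms.timeMeasure T), 0 ≤ f t v)
    (u₀ : ParabolicForms.L2 Ω) (hu₀ : 0 ≤ u₀)
    (uD uN : ℝ → ParabolicForms.L2 Ω)
    (huD : ParabolicForms.IsDirichletSolution T a f u₀ uD)
    (huN : ParabolicForms.IsNeumannSolution T a f u₀ uN) :
    ∀ t ∈ Icc 0 T, 0 ≤ uD t ∧ uD t ≤ uN t := by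
  have ha := ParabolicForms.ae_isAccretiveAt ha_meas ha_bdd hη ha_ell
  have hf' := ParabolicForms.ae_forall_nonneg hf_nonneg
  have hN := huN.nonneg hT ha hf' hu₀
  exact fun t ht => ⟨huD.nonneg hT ha hf' hu₀ t ht, huD.le_neumann hT ha huN hN t ht⟩
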